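/- **Setting.** Let $z\sim\mathcal N(0,1)$, let $\mathrm{He}_k$ be the $k$-th probabilist's Hermite polynomial and $u_k(g)=\mathbb E[g(z)\mathrm{He}_k(z)]$. Let $\sigma_*:\mathbb R\to\mathbb R$ be measurable with at most polynomial growth, with information exponent $p=\min\{k>0: u_k(\sigma_*)\neq 0\}$ (assumed to exist), and let $\sigma$ be a polynomial with $u_p(\sigma_*)u_p(\sigma)>0$; neither depends on the dimension $d$. For $d\ge 1$ and a unit vector $\theta_*\in\mathbb S^{d-1}$, data are i.i.d. pairs $(x^{(t)},y^{(t)})$, $t=0,1,2,\dots$, with $x^{(t)}\sim\mathcal N(0,I_d)$ and $y^{(t)}=\sigma_*(\langle x^{(t)},\theta_*\rangle)+\zeta^{(t)}$, where the noise $\zeta^{(t)}$ is independent of $x^{(t)}$, symmetric, and sub-Weibull: $\mathbb P(|\zeta^{(t)}|\ge x)\le A\exp(-Bx^{1/\tau})$ for all $x>0$, with $A,B,\tau>0$ not depending on $d$. Spherical online SGD on the correlation loss $1-y\,\sigma(\langle x,w\rangle)$ with learning rate $\gamma$ is, from $w^{(0)}\in\mathbb S^{d-1}$, $$w^{(t+1)}=\frac{v^{(t)}}{\|v^{(t)}\|},\qquad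 v^{(t)}=w^{(t)}+\gamma\, y^{(t)}\sigma'(\langle x^{(t)},w^{(t)}\rangle)\,\bigl(I_d-w^{(t)}w^{(t)\top}\bigr)x^{(t)} .$$ For sequences in $d$, write $f\asymp_b g$ if $g(d)(\log d)^{-b}\le f(d)\le (\log d)^b g(d)$ for all large $d$. Throughout, $\theta_*,w^{(0)}\in\mathbb S^{d-1}$ and $\gamma$ are deterministic and depend on $d$, with $$\langle\theta_*,w^{(0)}\rangle\asymp_b d^{-1/2},\qquad \gamma\asymp_{b'}d^{-(\frac p2\vee 1)} .$$ All exponents $a,a',b,b',c,m$ are non-negative integers. **Statement.** $\tilde\Theta(d^{(p-1)\vee1})$ iterations are necessary and sufficient for weak recovery ($\langle\theta_*,w\rangle\ge 1/\mathrm{polylog}(d)$) with high probability, in the following sense. Fix $b$. 1. (Necessity.) For all $b',c$ there is $a$ such that, for all $\theta_*,w^{(0)},\gamma$ as above, with probability tending to $1$ as $d\to\infty$, $$\langle\theta_*,w^{(t)}\rangle<(\log d)^{-c}\quad\text{for all } t\le d^{(p-1)\vee1}(\log d)^{-a}.$$ 2. (Sufficiency.) There is $m$ such that for all $b'$ there are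 $a,c$ such that, for all $\theta_*,w^{(0)},\gamma$ as above for which moreover $\gamma\le(\log d)^{-m}d^{-(\frac p2\vee1)}$ for all large $d$, and for every $a'$ and all integers $T=T(d)$ with $(\log d)^{a}d^{(p-1)\vee1}\le T\le(\log d)^{a'}d^{(p-1)\vee1}$ for all large $d$, with probability tending to $1$ as $d\to\infty$, $$\langle\theta_*,w^{(T)}\rangle\ge(\log d)^{-c}.$$ The exponents $a,c,m$ may depend on $\sigma_*,\sigma$, the noise laws and the exponents quantified before them, but not on $\theta_*,w^{(0)},\gamma$ or $d$. -/

import Mathlib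

open MeasureTheory ProbabilityTheory Filter Topology
open scoped Polynomial

namespace OnlineSGD

noncomputable section

/-- The ambient Euclidean space `ℝ^d`. -/
abbrev E (d : ℕ) : Type := EuclideanSpace ℝ (Fin d)

/-- The `k`-th Hermite coefficient `u_k(g) = 𝔼[g(z) He_k(z)]`, `z ∼ N(0,1)`, where `He_k` is the
`k`-th probabilist's Hermite polynomial. -/
def hermiteCoeff (g : ℝ → ℝ) (k : ℕ) : ℝ :=
  ∫ z, g z * Polynomial.aeval z (Polynomial.hermite k) ∂(gaussianReal 0 1)

/-- `p` is the information exponent of `g`: the least `k > 0` with `u_k(g) ≠ 0`. -/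
def IsInformationExponent (g : ℝ → ℝ) (p : ℕ) : Prop :=
  IsLeast {k : ℕ | 0 < k ∧ hermiteCoeff g k ≠ 0} p

/-- At most polynomial growth: `|g(z)| ≤ K₁ (1 + |z|)^K₂` for constants `K₁, K₂ > 0`. -/
def PolynomialGrowth (g : ℝ → ℝ) : Prop :=
  ∃ K₁ K₂ : ℝ, 0 < K₁ ∧ 0 < K₂ ∧ ∀ z, |g z| ≤ K₁ * (1 + |z|) ^ K₂

/-- The law `ν` on `ℝ` is symmetric about the origin. -/
def IsSymmetricLaw (ν : Measure ℝ) : Prop := ν.map (fun z => -z) = ν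

/-- The laws `ν d` are sub-Weibull, with tail parameter and constants that do not depend on `d`. -/
def UniformlySubWeibull (ν : ℕ → Measure ℝ) : Prop :=
  ∃ τ A B : ℝ, 0 < τ ∧ 0 < A ∧ 0 < B ∧ ∀ d : ℕ, ∀ x : ℝ, 0 < x →
    ν d {z | x ≤ |z|} ≤ ENNReal.ofReal (A * Real.exp (-B * x ^ (1 / τ)))

/-- The joint law of the i.i.d. sequence `(x_t, ζ_t)`, `t = 0, 1, 2, …`, of inputs
`x_t ∼ N(0, I_d)` and independent label noises `ζ_t ∼ ν`. -/
def dataLaw (d : ℕ) (ν : Measure ℝ) [IsProbabilityMeasure ν] : Measure (ℕ → E d × ℝ) :=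
  Measure.infinitePi (fun _ : ℕ => (stdGaussian (E d)).prod ν)

/-- The label `y = σ_*(⟨x, θ⟩) + ζ` of a data point given by its input and its noise. -/
def label {d : ℕ} (σs : ℝ → ℝ) (θ : E d) (s : E d × ℝ) : ℝ := σs (inner ℝ s.1 θ) + s.2

/-- `P_w x = x - ⟨w, x⟩ w`, the projection on the tangent space at `w` of the unit sphere. -/
def tangentProj {d : ℕ} (w x : E d) : E d := x - (inner ℝ w x : ℝ) • w

/-- One step of spherical online SGD on the correlation loss `1 - y σ(⟨x, w⟩)`:
`w + γ y σ'(⟨x, w⟩) P_w x`, divided by its norm. -/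
def sgdStep {d : ℕ} (σ : ℝ[X]) (γ : ℝ) (w x : E d) (y : ℝ) : E d :=
  let v := w + (γ * y * σ.derivative.eval (inner ℝ x w)) • tangentProj w x
  ‖v‖⁻¹ • v

/-- The iterate `w^{(t)}` of spherical online SGD; step `t` uses the fresh data point `ω t`. -/
def iterate {d : ℕ} (σs : ℝ → ℝ) (σ : ℝ[X]) (γ : ℝ) (θ w₀ : E d) (ω : ℕ → E d × ℝ) : ℕ → E d
  | 0 => w₀
  | t + 1 =>
      sgdStep σ γ (iterate σs σ γ θ w₀ ω t) (ω t).1 (label σs θ (ω t))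

/-- The alignment `⟨θ, w^{(t)}⟩` of the `t`-th iterate with the ground truth direction. -/
def alignment {d : ℕ} (σs : ℝ → ℝ) (σ : ℝ[X]) (γ : ℝ) (θ w₀ : E d) (ω : ℕ → E d × ℝ) (t : ℕ) : ℝ :=
  inner ℝ θ (iterate σs σ γ θ w₀ ω t)

/-- `f ≍ g` up to a polylogarithmic factor of degree `b`:
`g(d) / (log d)^b ≤ f(d) ≤ (log d)^b g(d)` for all large `d`. -/
def PolylogComparable (b : ℕ) (f g : ℕ → ℝ) : Prop :=
  ∀ᶠ d : ℕ in atTop, g d / Real.log d ^ b ≤ f d ∧ f d ≤ Real.log d ^ b * g d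

/-- The ground truths and the initial weights are unit vectors with
`⟨θ_*, w^{(0)}⟩ ≍ d^{-1/2}`, up to a polylogarithmic factor of degree `b`.
(There is no unit vector for `d = 0`.) -/
def GoodInit (b : ℕ) (θ w₀ : ∀ d : ℕ, E d) : Prop :=
  (∀ d : ℕ, 1 ≤ d → ‖θ d‖ = 1 ∧ ‖w₀ d‖ = 1) ∧
    PolylogComparable b (fun d => inner ℝ (θ d) (w₀ d)) (fun d => (d : ℝ) ^ (-(1 / 2) : ℝ))

/-- The learning rate scale `d^{-(p/2 ∨ 1)}`. -/
def stepScale (p d : ℕ) : ℝ := (d : ℝ) ^ (-(max ((p : ℝ) / 2) 1))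

/-- The iteration scale `d^{(p-1) ∨ 1}` (for `p ≥ 1`). -/
def iterScale (p d : ℕ) : ℝ := (d : ℝ) ^ max (p - 1) 1

end

end OnlineSGD

/-! Everything reduces to the scalar process `κ_t = ⟨θ, w_t⟩`. Its Doob decomposition
(`alignment_eq`) is `κ_0` plus a sum of conditional mean increments plus a martingale. Expanding
`σ'` in Hermite polynomials, the population gradient along `θ` is `(1 - κ²) ∑ β_j u_{j+1}(σ_*) κ^j`;
the information exponent kills all modes below `p - 1`, and `u_p(σ_*) u_p(σ) > 0` makes the first
surviving coefficient positive. Hence the drift is about `γ κ^(p-1)`, with normalisation errors `|κ|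
γ² d + γ³ d`, and a step has second moment at most `C (γ² + γ⁴ d²)` (`exists_increment_bounds`).

A maximal inequality (`measure_exists_compensated_le`) bounds the martingale over `n` steps by about
`γ √n`, up to logarithms, since `γ d` is at most polylogarithmic. With `γ ≈ d^(-(p/2 ∨ 1))` this
noise reaches order `d^(-1/2)` at `n ≈ d^((p-1) ∨ 1)`. If `p ≥ 2`, the drift accumulated at height
`R ≈ d^(-1/2)` becomes comparable to `R` at the same time, so for fewer steps the process cannot
leave `[-R, R]`. If `p = 1`, the same argument works with `R` an inverse power of `log d`.

For sufficiency, as long as `κ ≥ κ_0 / 2` the drift is at least `l κ` with `l ≈ γ κ_0^r`, `r = p -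
2` (truncated), so `κ` grows geometrically and exceeds a constant `δ` after about `log d / l` steps.
The extra factor `(log d)^(-m)` in `γ` keeps the noise below `κ_0 / 2` during this phase and makes
the error `κ γ² d` smaller than the drift. Afterwards the drift is nonnegative on `[δ/2, δ]` and the
noise over all `T` steps is `o(1)`, so the alignment does not fall below `δ/2`. -/

namespace OnlineSGD

/-! ### A maximal inequality for chains driven by i.i.d. inputs -/

section Chain

variable {S X : Type*}

/-- The chain started at `w` and driven by the sequence `ω` of inputs. -/
def chain (step : S → X → S) (w : S) (ω : ℕ → X) : ℕ → S
  | 0 => w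
  | t + 1 => step (chain step w ω t) (ω t)

/-- The sequence with first term `p.1`, followed by the sequence `p.2`. -/
def consSeq (p : X × (ℕ → X)) : ℕ → X
  | 0 => p.1
  | n + 1 => p.2 n

lemma chain_consSeq (step : S → X → S) (w : S) (p : X × (ℕ → X)) (t : ℕ) :
    chain step w (consSeq p) (t + 1) = chain step (step w p.1) p.2 t := by
  induction t with
  | zero => rfl
  | succ t ih => rw [chain, ih]; rfl

/-- The compensated process `f(w_n) - f(w_0) - ∑_{s < n} D(w_s)`. -/
def compensated (step : S → X → S) (f D : S → ℝ) (w : S) (ω : ℕ → X) (n : ℕ) : ℝ :=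
  f (chain step w ω n) - f w - ∑ s ∈ Finset.range n, D (chain step w ω s)

/-- First-step analysis: the remaining process is of the same kind, started at the new state. The
induction in the maximal inequality runs on this identity. -/
lemma compensated_consSeq (step : S → X → S) (f D : S → ℝ) (w : S) (p : X × (ℕ → X)) (n : ℕ) :
    compensated step f D w (consSeq p) (n + 1) =
      (f (step w p.1) - f w - D w) + compensated step f D (step w p.1) p.2 n := by
  simp only [compensated, Finset.sum_range_succ', chain_consSeq]
  simp only [chain]
  ring

lemma compensated_succ (step : S → X → S) (f D : S → ℝ) (w : S) (ω : ℕ → X) (n : ℕ) :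
    f (chain step w ω n) =
      f w + ∑ s ∈ Finset.range n, D (chain step w ω s) + compensated step f D w ω n := by
  simp only [compensated]
  ring

variable [MeasurableSpace S] [MeasurableSpace X]

lemma measurable_consSeq : Measurable (consSeq : X × (ℕ → X) → ℕ → X) := by
  refine measurable_pi_lambda _ fun n => ?_
  cases n with
  | zero => exact measurable_fst
  | succ n => exact (measurable_pi_apply n).comp measurable_snd

/-- An i.i.d. sequence is one input followed by an independent copy of itself; this lets Fubini
replace conditional expectations and filtrations. -/
lemma map_consSeq (μ : Measure X) [IsProbabilityMeasure μ] :
    (μ.prod (Measure.infinitePi fun _ : ℕ => μ)).map consSeq =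
      Measure.infinitePi fun _ : ℕ => μ := by
  classical
  refine Measure.eq_infinitePi _ fun s t ht => ?_
  rw [Measure.map_apply measurable_consSeq (.pi s.countable_toSet fun i _ => ht i)]
  set s' : Finset ℕ := (s.erase 0).image Nat.pred with hs'
  have hmem : ∀ n, n ∈ s' ↔ n + 1 ∈ s := by
    intro n
    simp only [hs', Finset.mem_image, Finset.mem_erase]
    constructor
    · rintro ⟨k, ⟨hk0, hk⟩, rfl⟩
      rwa [Nat.pred_eq_sub_one, Nat.sub_add_cancel (Nat.pos_of_ne_zero hk0)]
    · intro h
      exact ⟨n + 1, ⟨by omega, h⟩, rfl⟩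
  have hpre : consSeq ⁻¹' (Set.pi s t : Set (ℕ → X)) =
      (if 0 ∈ s then t 0 else Set.univ) ×ˢ (Set.pi s' fun n => t (n + 1)) := by
    ext p
    simp only [Set.mem_preimage, Set.mem_pi, Finset.mem_coe, Set.mem_prod, hmem]
    constructor
    · intro h
      refine ⟨?_, fun n hn => h (n + 1) hn⟩
      split_ifs with h0
      · exact h 0 h0
      · trivial
    · rintro ⟨h0, h1⟩ n hn
      cases n with
      | zero => rw [if_pos hn] at h0; exact h0
      | succ n => exact h1 n hn
  rw [hpre, Measure.prod_prod, Measure.infinitePi_pi _ fun i _ => ht (i + 1)]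
  have himg : ∏ n ∈ s', μ (t (n + 1)) = ∏ n ∈ s.erase 0, μ (t n) := by
    rw [hs', Finset.prod_image]
    · refine Finset.prod_congr rfl fun n hn => ?_
      rw [Nat.pred_eq_sub_one, Nat.sub_add_cancel (Nat.pos_of_ne_zero (Finset.ne_of_mem_erase hn))]
    · intro x hx y hy hxy
      have := Finset.ne_of_mem_erase hx
      have := Finset.ne_of_mem_erase hy
      simp only [Nat.pred_eq_sub_one] at hxy
      omega
  rw [himg]
  split_ifs with h0
  · exact Finset.mul_prod_erase s (fun n => μ (t n)) h0
  · rw [measure_univ, one_mul, Finset.erase_eq_of_notMem h0]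

variable {step : S → X → S} {f D : S → ℝ}

lemma measurable_chain (hstep : Measurable (Function.uncurry step)) (t : ℕ) :
    Measurable fun q : S × (ℕ → X) => chain step q.1 q.2 t := by
  induction t with
  | zero => exact measurable_fst
  | succ t ih =>
    exact hstep.comp (ih.prodMk ((measurable_pi_apply t).comp measurable_snd))

lemma measurable_compensated (hstep : Measurable (Function.uncurry step)) (hf : Measurable f)
    (hD : Measurable D) (n : ℕ) :
    Measurable fun q : S × (ℕ → X) => compensated step f D q.1 q.2 n := by
  unfold compensated
  refine ((hf.comp (measurable_chain hstep n)).sub (hf.comp measurable_fst)).sub ?_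
  exact Finset.measurable_sum _ fun s _ => hD.comp (measurable_chain hstep s)

lemma measurableSet_exists_compensated (hstep : Measurable (Function.uncurry step))
    (hf : Measurable f) (hD : Measurable D) (n : ℕ) (ε : ℝ) :
    MeasurableSet {q : ℝ × S × (ℕ → X) | ∃ t ≤ n, ε ≤ |q.1 + compensated step f D q.2.1 q.2.2 t|} := by
  have : {q : ℝ × S × (ℕ → X) | ∃ t ≤ n, ε ≤ |q.1 + compensated step f D q.2.1 q.2.2 t|} =
      ⋃ t ∈ Set.Iic n, {q | ε ≤ |q.1 + compensated step f D q.2.1 q.2.2 t|} := by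
    ext; simp
  rw [this]
  refine MeasurableSet.biUnion (Set.to_countable _) fun t _ => ?_
  refine measurableSet_le measurable_const ?_
  exact (measurable_fst.add ((measurable_compensated hstep hf hD t).comp measurable_snd)).abs

/-- **Kolmogorov's maximal inequality** for the compensated process of a chain driven by an
i.i.d. sequence. -/
theorem measure_exists_compensated_le (μ : Measure X) [IsProbabilityMeasure μ]
    (hstep : Measurable (Function.uncurry step)) (hf : Measurable f) (hD : Measurable D)
    {I : Set S} (hI : ∀ w ∈ I, ∀ x, step w x ∈ I)
    (hL2 : ∀ w ∈ I, MemLp (fun x => f (step w x) - f w) 2 μ)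
    (hDI : ∀ w ∈ I, D w = ∫ x, (f (step w x) - f w) ∂μ)
    {V : ℝ} (hV : ∀ w ∈ I, ∫ x, (f (step w x) - f w) ^ 2 ∂μ ≤ V) {ε : ℝ} (hε : 0 < ε)
    (n : ℕ) : ∀ w ∈ I, ∀ m : ℝ,
    (Measure.infinitePi fun _ : ℕ => μ)
      {ω | ∃ t ≤ n, ε ≤ |m + compensated step f D w ω t|} ≤
        ENNReal.ofReal ((m ^ 2 + n * V) / ε ^ 2) := by
  -- The start `w` and the offset `m` are universally quantified inside the induction: after one
  -- step the offset becomes `m` plus the first compensated increment. If `|m| ≥ ε`, the claimed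
  -- bound is at least `1`.
  have hVnn : ∀ w ∈ I, 0 ≤ V := fun w hw =>
    (integral_nonneg fun x => sq_nonneg _).trans (hV w hw)
  have htriv : ∀ n : ℕ, ∀ w ∈ I, ∀ m : ℝ, ε ≤ |m| →
      (Measure.infinitePi fun _ : ℕ => μ)
        {ω | ∃ t ≤ n, ε ≤ |m + compensated step f D w ω t|} ≤
          ENNReal.ofReal ((m ^ 2 + n * V) / ε ^ 2) := by
    intro n w hw m hm
    refine prob_le_one.trans ?_
    rw [← ENNReal.ofReal_one]
    refine ENNReal.ofReal_le_ofReal ?_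
    rw [le_div_iff₀ (by positivity), one_mul]
    have h1 : ε ^ 2 ≤ m ^ 2 := by rw [← sq_abs m]; gcongr
    have := mul_nonneg (Nat.cast_nonneg (α := ℝ) n) (hVnn w hw)
    linarith
  induction n with
  | zero =>
    intro w hw m
    by_cases hm : ε ≤ |m|
    · exact htriv 0 w hw m hm
    · have : {ω : ℕ → X | ∃ t ≤ 0, ε ≤ |m + compensated step f D w ω t|} = ∅ := by
        ext ω
        simp [compensated, chain, hm]
      rw [this, measure_empty]
      exact zero_le
  | succ n ih =>
    intro w hw m
    by_cases hm : ε ≤ |m|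
    · exact htriv (n + 1) w hw m hm
    have hms := measurableSet_exists_compensated hstep hf hD (n + 1) ε
    have hms' := measurableSet_exists_compensated hstep hf hD n ε
    have hsec : MeasurableSet {ω : ℕ → X | ∃ t ≤ n + 1, ε ≤ |m + compensated step f D w ω t|} :=
      (measurable_const.prodMk (measurable_const.prodMk measurable_id) :
        Measurable fun ω : ℕ → X => (m, w, ω)) hms
    have hstepw : Measurable (step w) := hstep.comp (measurable_const.prodMk measurable_id)
    have hpre : consSeq ⁻¹' {ω : ℕ → X | ∃ t ≤ n + 1, ε ≤ |m + compensated step f D w ω t|} =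
        (fun p : X × (ℕ → X) => (m + (f (step w p.1) - f w - D w), step w p.1, p.2)) ⁻¹'
          {q | ∃ t ≤ n, ε ≤ |q.1 + compensated step f D q.2.1 q.2.2 t|} := by
      ext p
      simp only [Set.mem_preimage, Set.mem_ofPred_eq]
      constructor
      · rintro ⟨t, ht, h⟩
        cases t with
        | zero => exact absurd (by simpa [compensated, chain] using h) hm
        | succ t =>
          refine ⟨t, by omega, ?_⟩
          rw [compensated_consSeq] at h
          convert h using 2
          ring
      · rintro ⟨t, ht, h⟩
        refine ⟨t + 1, by omega, ?_⟩
        rw [compensated_consSeq]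
        convert h using 2
        ring
    have hmeas : Measurable fun p : X × (ℕ → X) =>
        (m + (f (step w p.1) - f w - D w), step w p.1, p.2) := by
      have h1 : Measurable fun p : X × (ℕ → X) => step w p.1 := hstepw.comp measurable_fst
      exact ((((hf.comp h1).sub_const _).sub_const _).const_add _).prodMk
        (h1.prodMk measurable_snd)
    rw [← map_consSeq μ, Measure.map_apply measurable_consSeq hsec, hpre,
      Measure.prod_apply (hmeas hms')]
    set Δ : X → ℝ := fun x => f (step w x) - f w with hΔ
    have hint : Integrable Δ μ := (hL2 w hw).integrable (by norm_num)
    have hint2 : Integrable (fun x => Δ x ^ 2) μ := (hL2 w hw).integrable_sq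
    have hexp : ∀ x, ((m + (Δ x - D w)) ^ 2 + n * V) / ε ^ 2 =
        ((m - D w) ^ 2 + n * V) / ε ^ 2 + 2 * (m - D w) / ε ^ 2 * Δ x + 1 / ε ^ 2 * Δ x ^ 2 := by
      intro x
      ring
    have hint3 : Integrable (fun x => ((m + (Δ x - D w)) ^ 2 + n * V) / ε ^ 2) μ := by
      simp_rw [hexp]
      exact ((integrable_const _).add (hint.const_mul _)).add (hint2.const_mul _)
    calc _ ≤ ∫⁻ x, ENNReal.ofReal (((m + (Δ x - D w)) ^ 2 + n * V) / ε ^ 2) ∂μ :=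
          lintegral_mono fun x => ih (step w x) (hI w hw x) (m + (Δ x - D w))
      _ = ENNReal.ofReal (∫ x, ((m + (Δ x - D w)) ^ 2 + n * V) / ε ^ 2 ∂μ) := by
          rw [ofReal_integral_eq_lintegral_ofReal hint3]
          have := hVnn w hw
          exact Eventually.of_forall fun x => by positivity
      _ ≤ _ := by
          refine ENNReal.ofReal_le_ofReal ?_
          simp_rw [hexp]
          have hlin : Integrable (fun x => ((m - D w) ^ 2 + n * V) / ε ^ 2 +
              2 * (m - D w) / ε ^ 2 * Δ x) μ := (integrable_const _).add (hint.const_mul _)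
          rw [integral_add hlin (hint2.const_mul _),
            integral_add (integrable_const _) (hint.const_mul _), integral_const_mul,
            integral_const_mul, integral_const, ← hDI w hw]
          have hV' : ∫ x, Δ x ^ 2 ∂μ ≤ V := hV w hw
          simp only [probReal_univ, one_smul]
          -- The compensated increment has mean zero, so its cross term with `m` vanishes and its
          -- second moment is `∫ Δ² - D² ≤ V`. The slack is displayed explicitly.
          rw [← sub_nonneg]
          have : (m ^ 2 + ((n + 1 : ℕ) : ℝ) * V) / ε ^ 2 - (((m - D w) ^ 2 + n * V) / ε ^ 2 +
              2 * (m - D w) / ε ^ 2 * D w + 1 / ε ^ 2 * ∫ x, Δ x ^ 2 ∂μ) =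
              (D w ^ 2 + (V - ∫ x, Δ x ^ 2 ∂μ)) / ε ^ 2 := by
            push_cast
            field_simp
            ring
          rw [this]
          have := sub_nonneg.mpr hV'
          positivity

end Chain

/-! ### Hermite polynomials over the reals -/

section Hermite

open Polynomial in
/-- The probabilist's Hermite polynomial with real coefficients. -/
noncomputable def hermiteReal (n : ℕ) : ℝ[X] := (hermite n).map (Int.castRingHom ℝ)

open Polynomial in
lemma aeval_hermite (n : ℕ) (x : ℝ) : aeval x (hermite n) = (hermiteReal n).eval x := by
  rw [hermiteReal, eval_map, aeval_def]
  rfl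

open Polynomial in
lemma hermiteReal_zero : hermiteReal 0 = 1 := by
  simp [hermiteReal]

open Polynomial in
lemma hermiteReal_succ (n : ℕ) :
    hermiteReal (n + 1) = X * hermiteReal n - derivative (hermiteReal n) := by
  simp [hermiteReal, hermite_succ, derivative_map]

open Polynomial in
lemma derivative_hermiteReal_succ (n : ℕ) :
    derivative (hermiteReal (n + 1)) = (n + 1 : ℝ[X]) * hermiteReal n := by
  induction n with
  | zero => simp [hermiteReal_succ, hermiteReal_zero]
  | succ n ih =>
    rw [hermiteReal_succ (n + 1), derivative_sub, derivative_mul, derivative_X, ih, derivative_mul,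
      hermiteReal_succ n]
    have : derivative ((n : ℝ[X]) + 1) = 0 := by simp
    rw [this]
    push_cast
    ring

open Polynomial in
lemma derivative_hermiteReal (n : ℕ) :
    derivative (hermiteReal n) = (n : ℝ[X]) * hermiteReal (n - 1) := by
  cases n with
  | zero => simp [hermiteReal_zero]
  | succ n => rw [derivative_hermiteReal_succ]; simp

open Polynomial in
lemma natDegree_hermiteReal (n : ℕ) : (hermiteReal n).natDegree = n := by
  rw [hermiteReal, (hermite_monic n).natDegree_map, natDegree_hermite]

open Polynomial in
/-- Every real polynomial is a linear combination of Hermite polynomials. -/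
lemma exists_eq_sum_hermiteReal (P : ℝ[X]) :
    ∃ (n : ℕ) (c : ℕ → ℝ), P = ∑ k ∈ Finset.range n, C (c k) * hermiteReal k := by
  suffices h : ∀ n : ℕ, ∀ P : ℝ[X], P.degree < n →
      ∃ c : ℕ → ℝ, P = ∑ k ∈ Finset.range n, C (c k) * hermiteReal k by
    obtain ⟨c, hc⟩ := h (P.natDegree + 1) P (degree_lt_iff_coeff_zero _ _ |>.2 fun m hm =>
      coeff_eq_zero_of_natDegree_lt (by omega))
    exact ⟨_, c, hc⟩
  intro n
  induction n with
  | zero =>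
    intro P hP
    refine ⟨0, ?_⟩
    have : P = 0 := by
      ext m
      rw [(degree_lt_iff_coeff_zero P 0).1 (by simpa using hP) m (Nat.zero_le _)]
      simp
    simp [this]
  | succ n ih =>
    intro P hP
    -- `hermiteReal n` is monic of degree `n`, so subtracting the leading term lowers the degree.
    have hdeg : (P - C (P.coeff n) * hermiteReal n).degree < n := by
      rw [degree_lt_iff_coeff_zero]
      intro m hm
      rcases hm.eq_or_lt with rfl | hlt
      · have : (hermiteReal n).coeff n = 1 := by simp [hermiteReal, coeff_hermite_self]
        simp [this]
      · have h1 := (degree_lt_iff_coeff_zero P (n + 1)).1 hP m hlt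
        have h2 : (hermiteReal n).coeff m = 0 :=
          coeff_eq_zero_of_natDegree_lt (by rw [natDegree_hermiteReal]; exact hlt)
        simp [h1, h2]
    obtain ⟨c, hc⟩ := ih _ hdeg
    refine ⟨fun k => if k = n then P.coeff n else c k, ?_⟩
    rw [Finset.sum_range_succ]
    simp only [if_true]
    rw [← sub_eq_iff_eq_add, hc]
    refine Finset.sum_congr rfl fun k hk => ?_
    rw [if_neg (Finset.mem_range.1 hk).ne]

end Hermite

/-! ### Stein's identity and Hermite expansions under the Gaussian measure -/

section Gaussian

/-- The standard Gaussian measure on the line. -/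
noncomputable abbrev gauss : Measure ℝ := gaussianReal 0 1

lemma integrable_pow_gaussian (n : ℕ) : Integrable (fun x : ℝ => x ^ n) gauss := by
  rcases Nat.eq_zero_or_pos n with rfl | hn
  · simp
  have h := (memLp_id_gaussianReal (μ := 0) (v := 1) (n : NNReal)).integrable_norm_rpow
    (by simpa using hn.ne') (by simp)
  refine h.mono' (by fun_prop) (Eventually.of_forall fun x => ?_)
  simp

lemma integrable_eval_gaussian (P : ℝ[X]) : Integrable (fun x : ℝ => P.eval x) gauss := by
  simp_rw [Polynomial.eval_eq_sum_range]
  exact integrable_finsetSum _ fun i _ => (integrable_pow_gaussian i).const_mul _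

lemma hasDerivAt_gaussianPDFReal (x : ℝ) :
    HasDerivAt (gaussianPDFReal 0 1) (-(x * gaussianPDFReal 0 1 x)) x := by
  have h : gaussianPDFReal 0 1 = fun x : ℝ =>
      (Real.sqrt (2 * Real.pi))⁻¹ * Real.exp (-(x ^ 2) / 2) := by
    ext x
    simp [gaussianPDFReal]
  rw [h]
  have h1 : HasDerivAt (fun x : ℝ => -(x ^ 2) / 2) (-(2 * x) / 2) x := by
    have := ((hasDerivAt_pow 2 x).neg).div_const 2
    simpa using this
  refine (h1.exp.const_mul (Real.sqrt (2 * Real.pi))⁻¹).congr_deriv ?_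
  ring

lemma integrable_gaussian_iff {f : ℝ → ℝ} :
    Integrable f gauss ↔ Integrable (fun x => gaussianPDFReal 0 1 x * f x) := by
  rw [gauss, gaussianReal_of_var_ne_zero 0 one_ne_zero, integrable_withDensity_iff_integrable_smul₀'
    (measurable_gaussianPDF _ _).aemeasurable (ae_of_all _ fun _ => gaussianPDF_lt_top)]
  simp

/-- **Stein's identity** for polynomials. -/
lemma integral_mul_eval_gaussian (P : ℝ[X]) :
    ∫ x, x * P.eval x ∂gauss = ∫ x, P.derivative.eval x ∂gauss := by
  have hX : ∀ x : ℝ, x * P.eval x = (Polynomial.X * P).eval x := fun x => by simp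
  rw [integral_gaussianReal_eq_integral_smul one_ne_zero,
    integral_gaussianReal_eq_integral_smul one_ne_zero]
  -- Integration by parts, using that the Gaussian density `φ` satisfies `φ' = -x φ`.
  have h := integral_mul_deriv_eq_deriv_mul_of_integrable (u := fun x => P.eval x)
    (v := gaussianPDFReal 0 1) (u' := fun x => P.derivative.eval x)
    (v' := fun x => -(x * gaussianPDFReal 0 1 x)) (fun x _ => P.hasDerivAt x)
    (fun x _ => hasDerivAt_gaussianPDFReal x) ?_ ?_ ?_
  · have h1 : ∀ x, P.eval x * -(x * gaussianPDFReal 0 1 x) =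
        -(gaussianPDFReal 0 1 x • (x * P.eval x)) := fun x => by rw [smul_eq_mul]; ring
    simp_rw [h1, integral_neg, neg_inj] at h
    rw [h]
    refine integral_congr_ae (Eventually.of_forall fun x => ?_)
    simp [mul_comm]
  · refine (integrable_gaussian_iff.1 (integrable_eval_gaussian (Polynomial.X * P))).neg.congr ?_
    refine Eventually.of_forall fun x => ?_
    simp
    ring
  · refine (integrable_gaussian_iff.1 (integrable_eval_gaussian P.derivative)).congr ?_
    refine Eventually.of_forall fun x => ?_
    simp [mul_comm]
  · refine (integrable_gaussian_iff.1 (integrable_eval_gaussian P)).congr ?_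
    refine Eventually.of_forall fun x => ?_
    simp [mul_comm]

lemma integrable_eval_affine (P : ℝ[X]) (a s : ℝ) :
    Integrable (fun z => P.eval (a + s * z)) gauss := by
  refine (integrable_eval_gaussian
    (P.comp (Polynomial.C a + Polynomial.C s * Polynomial.X))).congr ?_
  exact Eventually.of_forall fun z => by simp [Polynomial.eval_comp]

lemma integrable_mul_eval_affine (P : ℝ[X]) (a s : ℝ) :
    Integrable (fun z => z * P.eval (a + s * z)) gauss := by
  refine (integrable_eval_gaussian
    (Polynomial.X * P.comp (Polynomial.C a + Polynomial.C s * Polynomial.X))).congr ?_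
  exact Eventually.of_forall fun z => by simp [Polynomial.eval_comp]

lemma integral_mul_eval_affine (P : ℝ[X]) (a s : ℝ) :
    ∫ z, z * P.eval (a + s * z) ∂gauss = s * ∫ z, P.derivative.eval (a + s * z) ∂gauss := by
  have h := integral_mul_eval_gaussian (P.comp (Polynomial.C a + Polynomial.C s * Polynomial.X))
  simp only [Polynomial.derivative_comp, Polynomial.eval_mul, Polynomial.eval_comp] at h
  simpa [integral_const_mul] using h

/-- Hermite polynomials are eigenfunctions of the Ornstein–Uhlenbeck semigroup. -/
lemma integral_hermiteReal_affine {κ s : ℝ} (hs : κ ^ 2 + s ^ 2 = 1) (j : ℕ) (v : ℝ) :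
    ∫ z, (hermiteReal j).eval (κ * v + s * z) ∂gauss = κ ^ j * (hermiteReal j).eval v := by
  -- The three-term recurrence calls on the two preceding indices. Stein's identity in `z` produces
  -- a factor `s²`, and `s² - 1 = -κ²` restores the recurrence at `v`.
  induction j using Nat.strong_induction_on with
  | _ j ih =>
  cases j with
  | zero => simp [hermiteReal_zero]
  | succ j =>
    have h1 : ∀ z, (hermiteReal (j + 1)).eval (κ * v + s * z) =
        κ * v * (hermiteReal j).eval (κ * v + s * z) +
          s * (z * (hermiteReal j).eval (κ * v + s * z)) -
          j * (hermiteReal (j - 1)).eval (κ * v + s * z) := by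
      intro z
      rw [hermiteReal_succ, derivative_hermiteReal]
      simp
      ring
    have i1 := integrable_eval_affine (hermiteReal j) (κ * v) s
    have i2 := integrable_mul_eval_affine (hermiteReal j) (κ * v) s
    have i3 := integrable_eval_affine (hermiteReal (j - 1)) (κ * v) s
    have i12 : Integrable (fun z => κ * v * (hermiteReal j).eval (κ * v + s * z) +
          s * (z * (hermiteReal j).eval (κ * v + s * z))) gauss :=
      (i1.const_mul _).add (i2.const_mul _)
    have h2 : ∀ z, (hermiteReal j).derivative.eval (κ * v + s * z) =
        j * (hermiteReal (j - 1)).eval (κ * v + s * z) := by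
      intro z
      rw [derivative_hermiteReal]
      simp
    simp_rw [h1]
    rw [integral_sub i12 (i3.const_mul _), integral_add (i1.const_mul _) (i2.const_mul _)]
    simp_rw [integral_const_mul, integral_mul_eval_affine, h2, integral_const_mul]
    rw [ih j (by omega), ih (j - 1) (by omega), hermiteReal_succ, derivative_hermiteReal]
    cases j with
    | zero => simp [mul_assoc]
    | succ j =>
      simp
      have hs' : s ^ 2 = 1 - κ ^ 2 := by linarith
      linear_combination ((j : ℝ) + 1) * κ ^ j * (hermiteReal j).eval v * hs'

/-- The conditional expectation of `He_j(u) (v - κ u)` given `v`, where `u = κ v + s z`. -/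
lemma integral_hermiteReal_affine_mul {κ s : ℝ} (hs : κ ^ 2 + s ^ 2 = 1) (j : ℕ) (v : ℝ) :
    ∫ z, (hermiteReal j).eval (κ * v + s * z) * (v - κ * (κ * v + s * z)) ∂gauss =
      (1 - κ ^ 2) * κ ^ j * (hermiteReal (j + 1)).eval v := by
  have h1 : ∀ z, (hermiteReal j).eval (κ * v + s * z) * (v - κ * (κ * v + s * z)) =
      (1 - κ ^ 2) * v * (hermiteReal j).eval (κ * v + s * z) -
        κ * s * (z * (hermiteReal j).eval (κ * v + s * z)) := fun z => by ring
  have i1 := integrable_eval_affine (hermiteReal j) (κ * v) s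
  have i2 := integrable_mul_eval_affine (hermiteReal j) (κ * v) s
  have h2 : ∀ z, (hermiteReal j).derivative.eval (κ * v + s * z) =
      j * (hermiteReal (j - 1)).eval (κ * v + s * z) := by
    intro z
    rw [derivative_hermiteReal]
    simp
  simp_rw [h1]
  rw [integral_sub (i1.const_mul _) (i2.const_mul _)]
  simp_rw [integral_const_mul, integral_mul_eval_affine, h2, integral_const_mul,
    integral_hermiteReal_affine hs]
  rw [hermiteReal_succ, derivative_hermiteReal]
  have hs' : s ^ 2 = 1 - κ ^ 2 := by linarith
  cases j with
  | zero => simp [mul_assoc]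
  | succ j =>
    simp
    linear_combination -((j : ℝ) + 1) * κ ^ (j + 1) * (hermiteReal j).eval v * hs'

/-- By Stein's identity the raising operator `Q ↦ X Q - Q'`, which sends `He_k` to `He_(k+1)`, is
adjoint to differentiation. -/
lemma integral_eval_mul_hermiteReal (P : ℝ[X]) (k : ℕ) :
    ∫ z, P.eval z * (hermiteReal (k + 1)).eval z ∂gauss =
      ∫ z, P.derivative.eval z * (hermiteReal k).eval z ∂gauss := by
  have h := integral_mul_eval_gaussian (P * hermiteReal k)
  have h1 : ∀ z, P.eval z * (hermiteReal (k + 1)).eval z =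
      z * (P * hermiteReal k).eval z - (P * (hermiteReal k).derivative).eval z := by
    intro z
    rw [hermiteReal_succ]
    simp
    ring
  have h2 : ∀ z, P.derivative.eval z * (hermiteReal k).eval z =
      (P * hermiteReal k).derivative.eval z - (P * (hermiteReal k).derivative).eval z := by
    intro z
    simp
  simp_rw [h1, h2]
  have i1 : Integrable (fun z => z * (P * hermiteReal k).eval z) gauss := by
    simpa using integrable_mul_eval_affine (P * hermiteReal k) 0 1
  rw [integral_sub i1 (integrable_eval_gaussian _),
    integral_sub (integrable_eval_gaussian _) (integrable_eval_gaussian _), h]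

/-- Orthogonality of the Hermite polynomials for the standard Gaussian measure. -/
lemma integral_hermiteReal_mul_hermiteReal (i k : ℕ) :
    ∫ z, (hermiteReal i).eval z * (hermiteReal k).eval z ∂gauss =
      if i = k then (k.factorial : ℝ) else 0 := by
  induction k generalizing i with
  | zero =>
    cases i with
    | zero => simp [hermiteReal_zero]
    | succ i =>
      have := integral_eval_mul_hermiteReal 1 i
      simp only [Polynomial.derivative_one, Polynomial.eval_zero, zero_mul, integral_zero,
        Polynomial.eval_one, one_mul] at this
      simp [hermiteReal_zero, this]
  | succ k ih =>
    rw [integral_eval_mul_hermiteReal, derivative_hermiteReal]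
    cases i with
    | zero => simp
    | succ i =>
      have : ∀ z, ((((i + 1 : ℕ) : ℝ[X]) * hermiteReal (i + 1 - 1)).eval z) *
          (hermiteReal k).eval z = ((i + 1 : ℕ) : ℝ) *
            ((hermiteReal i).eval z * (hermiteReal k).eval z) := by
        intro z
        simp
        ring
      simp_rw [this, integral_const_mul, ih]
      by_cases h : i = k
      · subst h
        simp [Nat.factorial_succ]
      · simp [h]

/-- The Hermite coefficients of a polynomial and the Hermite expansion of its derivative. -/
lemma exists_derivative_eq_sum_hermiteReal (P : ℝ[X]) :
    ∃ (n : ℕ) (β : ℕ → ℝ),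
      P.derivative = ∑ j ∈ Finset.range n, Polynomial.C (β j) * hermiteReal j ∧
      (∀ j, hermiteCoeff (fun z => P.eval z) (j + 1) = j.factorial * β j) ∧
      ∀ j, n ≤ j → β j = 0 := by
  obtain ⟨n, c, hc⟩ := exists_eq_sum_hermiteReal P.derivative
  -- Truncating the coefficients at `n` makes the formula for the Hermite coefficients valid for
  -- every `j`.
  refine ⟨n, fun j => if j < n then c j else 0, ?_, ?_, ?_⟩
  · rw [hc]
    exact Finset.sum_congr rfl fun j hj => by simp only [if_pos (Finset.mem_range.1 hj)]
  · intro j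
    simp_rw [hermiteCoeff, aeval_hermite, integral_eval_mul_hermiteReal, hc,
      Polynomial.eval_finsetSum, Finset.sum_mul]
    have h1 : ∀ z i, (Polynomial.C (c i) * hermiteReal i).eval z * (hermiteReal j).eval z =
        c i * ((hermiteReal i).eval z * (hermiteReal j).eval z) := by
      intro z i
      simp
      ring
    simp_rw [h1]
    rw [integral_finsetSum]
    · simp_rw [integral_const_mul, integral_hermiteReal_mul_hermiteReal]
      simp [mul_comm]
    · intro i _
      simpa using (integrable_eval_gaussian (hermiteReal i * hermiteReal j)).const_mul (c i)
  · intro j hj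
    simp [hj.not_gt]

end Gaussian

/-! ### Joint law of two marginals of a Gaussian vector -/

section JointLaw

/-- The joint law of two one-dimensional marginals of a standard Gaussian vector. -/
lemma map_inner_inner_stdGaussian {d : ℕ} {θ w : E d} (hθ : ‖θ‖ = 1) (hw : ‖w‖ = 1) {s : ℝ}
    (hs : (inner ℝ θ w : ℝ) ^ 2 + s ^ 2 = 1) :
    (stdGaussian (E d)).map (fun x => ((inner ℝ x θ : ℝ), (inner ℝ x w : ℝ))) =
      (gauss.prod gauss).map (fun q : ℝ × ℝ => (q.1, inner ℝ θ w * q.1 + s * q.2)) := by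
  have : IsProbabilityMeasure ((stdGaussian (E d)).map
      (fun x => ((inner ℝ x θ : ℝ), (inner ℝ x w : ℝ)))) :=
    Measure.isProbabilityMeasure_map (by fun_prop)
  have : IsProbabilityMeasure ((gauss.prod gauss).map
      (fun q : ℝ × ℝ => (q.1, (inner ℝ θ w : ℝ) * q.1 + s * q.2))) :=
    Measure.isProbabilityMeasure_map (by fun_prop)
  -- Under either law the functional `(α, β)` is a centred Gaussian of variance `‖α θ + β w‖²`, so
  -- the characteristic functions agree.
  apply Measure.ext_of_charFunDual
  ext L
  set α := L (1, 0) with hα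
  set β := L (0, 1) with hβ
  have hL : ∀ a b : ℝ, L (a, b) = α * a + β * b := by
    intro a b
    have : ((a, b) : ℝ × ℝ) = a • (1, 0) + b • (0, 1) := by simp
    rw [this, map_add, map_smul, map_smul, ← hα, ← hβ, smul_eq_mul, smul_eq_mul]
    ring
  rw [charFunDual_apply, charFunDual_apply, integral_map (by fun_prop) (by fun_prop),
    integral_map (by fun_prop) (by fun_prop)]
  simp_rw [hL]
  have h1 : ∀ x : E d, α * inner ℝ x θ + β * inner ℝ x w = inner ℝ x (α • θ + β • w) := by
    intro x
    rw [inner_add_right, inner_smul_right, inner_smul_right]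
  simp_rw [h1]
  rw [← charFun_apply, charFun_stdGaussian]
  have h2 : ∀ q : ℝ × ℝ, Complex.exp (((α * q.1 + β * (inner ℝ θ w * q.1 + s * q.2) : ℝ) : ℂ) *
      Complex.I) = Complex.exp (((α + β * inner ℝ θ w : ℝ) : ℂ) * (q.1 : ℂ) * Complex.I) *
        Complex.exp (((β * s : ℝ) : ℂ) * (q.2 : ℂ) * Complex.I) := by
    intro q
    rw [← Complex.exp_add]
    congr 1
    push_cast
    ring
  simp_rw [h2]
  rw [integral_prod_mul (fun a : ℝ => Complex.exp (((α + β * inner ℝ θ w : ℝ) : ℂ) * (a : ℂ) *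
    Complex.I)) (fun a : ℝ => Complex.exp (((β * s : ℝ) : ℂ) * (a : ℂ) * Complex.I)),
    ← charFun_apply_real, ← charFun_apply_real, charFun_gaussianReal, charFun_gaussianReal,
    ← Complex.exp_add]
  congr 1
  have h3 : ‖α • θ + β • w‖ ^ 2 = α ^ 2 + 2 * (α * β * inner ℝ θ w) + β ^ 2 := by
    rw [norm_add_sq_real, norm_smul, norm_smul, hθ, hw, inner_smul_left, inner_smul_right]
    simp
    ring
  have h4 : -(‖α • θ + β • w‖ ^ 2) / 2 =
      -((α + β * inner ℝ θ w) ^ 2 / 2) + -((β * s) ^ 2 / 2) := by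
    rw [h3]
    linear_combination (β ^ 2 / 2) * hs
  have h5 := congrArg (fun r : ℝ => (r : ℂ)) h4
  push_cast at h5 ⊢
  simp only [mul_zero, zero_mul, zero_sub, one_mul]
  rw [h5]

/-- This is the degenerate case `θ = w`, `s = 0` of the joint law, projected to its first
coordinate. -/
lemma map_inner_stdGaussian {d : ℕ} {w : E d} (hw : ‖w‖ = 1) :
    (stdGaussian (E d)).map (fun x => (inner ℝ x w : ℝ)) = gauss := by
  have h := map_inner_inner_stdGaussian (θ := w) (w := w) hw hw (s := 0)
    (by simp [hw])
  have h1 := congrArg (fun m => m.map Prod.fst) h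
  simp only at h1
  rw [Measure.map_map (by fun_prop) (by fun_prop), Measure.map_map (by fun_prop) (by fun_prop)]
    at h1
  simp only [Function.comp_def] at h1
  rw [h1]
  exact Measure.fst_prod

end JointLaw

/-! ### Moment bounds uniform in the dimension -/

section Moments

/-- `f` is integrable with integral at most `C`. -/
def IntegralLE {α : Type*} [MeasurableSpace α] (f : α → ℝ) (μ : Measure α) (C : ℝ) : Prop :=
  Integrable f μ ∧ ∫ x, f x ∂μ ≤ C

section IntegralLE

variable {α β : Type*} [MeasurableSpace α] [MeasurableSpace β] {μ : Measure α} {f g : α → ℝ}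
  {C C' : ℝ}

lemma IntegralLE.add (hf : IntegralLE f μ C) (hg : IntegralLE g μ C') :
    IntegralLE (fun x => f x + g x) μ (C + C') :=
  ⟨hf.1.add hg.1, by rw [integral_add hf.1 hg.1]; exact add_le_add hf.2 hg.2⟩

lemma IntegralLE.const_mul (hf : IntegralLE f μ C) {a : ℝ} (ha : 0 ≤ a) :
    IntegralLE (fun x => a * f x) μ (a * C) :=
  ⟨hf.1.const_mul a, by rw [integral_const_mul]; exact mul_le_mul_of_nonneg_left hf.2 ha⟩

lemma IntegralLE.mono (hg : IntegralLE g μ C) (hf : AEStronglyMeasurable f μ)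
    (h : ∀ x, |f x| ≤ g x) : IntegralLE f μ C := by
  have hi : Integrable f μ := hg.1.mono' hf (Eventually.of_forall h)
  exact ⟨hi, (integral_mono hi hg.1 fun x => (le_abs_self _).trans (h x)).trans hg.2⟩

lemma IntegralLE.comp_fst {f : α → ℝ} (hf : IntegralLE f μ C) (ν : Measure β)
    [IsProbabilityMeasure ν] [SFinite μ] :
    IntegralLE (fun z : α × β => f z.1) (μ.prod ν) C :=
  ⟨hf.1.comp_fst ν, by rw [integral_fun_fst]; simpa using hf.2⟩

lemma IntegralLE.comp_snd {ν : Measure β} {f : β → ℝ} (hf : IntegralLE f ν C) (μ : Measure α)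
    [IsProbabilityMeasure μ] [SFinite ν] :
    IntegralLE (fun z : α × β => f z.2) (μ.prod ν) C :=
  ⟨hf.1.comp_snd μ, by rw [integral_fun_snd]; simpa using hf.2⟩

lemma IntegralLE.of_map {f : β → ℝ} {φ : α → β} {ν : Measure β} (h : μ.map φ = ν)
    (hφ : Measurable φ) (hf : IntegralLE f ν C) : IntegralLE (fun x => f (φ x)) μ C := by
  subst h
  exact ⟨hf.1.comp_measurable hφ, by
    rw [← integral_map hφ.aemeasurable hf.1.aestronglyMeasurable]; exact hf.2⟩

end IntegralLE

/-- Rounding the exponent up and using `1 + |z| ≤ 2 + 2 z²` gives a dominating function that is a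
genuine polynomial. -/
lemma PolynomialGrowth.integrable_pow {g : ℝ → ℝ} (hg : PolynomialGrowth g) (hm : Measurable g)
    (k : ℕ) : Integrable (fun z => g z ^ k) gauss := by
  obtain ⟨K₁, K₂, hK₁, hK₂, h⟩ := hg
  set n := ⌈K₂ * k⌉₊
  have hint : Integrable (fun z : ℝ => K₁ ^ k * (2 + 2 * z ^ 2) ^ n) gauss := by
    refine ((integrable_eval_gaussian ((Polynomial.C 2 + Polynomial.C 2 * Polynomial.X ^ 2) ^ n)
      ).congr (Eventually.of_forall fun z => ?_)).const_mul _
    simp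
  refine hint.mono' (hm.pow_const k).aestronglyMeasurable (Eventually.of_forall fun z => ?_)
  have h1 : (1 : ℝ) ≤ 1 + |z| := by linarith [abs_nonneg z]
  have h0 : (0 : ℝ) ≤ 1 + |z| := by linarith
  have h2 : 1 + |z| ≤ 2 + 2 * z ^ 2 := by
    rw [← sq_abs z]
    nlinarith [sq_nonneg (|z| - 1), sq_nonneg (|z|)]
  rw [Real.norm_eq_abs, abs_pow]
  calc |g z| ^ k ≤ (K₁ * (1 + |z|) ^ K₂) ^ k := pow_le_pow_left₀ (abs_nonneg _) (h z) k
    _ = K₁ ^ k * (1 + |z|) ^ (K₂ * k) := by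
        rw [mul_pow, Real.rpow_mul h0, Real.rpow_natCast]
    _ ≤ K₁ ^ k * (1 + |z|) ^ (n : ℝ) := by
        gcongr
        exact Nat.le_ceil _
    _ ≤ K₁ ^ k * (2 + 2 * z ^ 2) ^ n := by
        rw [Real.rpow_natCast]
        gcongr

/-- Uniformly sub-Weibull laws have uniformly bounded moments. -/
lemma UniformlySubWeibull.exists_moment_le {ν : ℕ → Measure ℝ} (hν : UniformlySubWeibull ν)
    {k : ℕ} (hk : 0 < k) (hk2 : Even k) :
    ∃ C : ℝ, ∀ d, IntegralLE (fun z => z ^ k) (ν d) C := by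
  obtain ⟨τ, A, B, hτ, hA, hB, h⟩ := hν
  set F : ℝ → ℝ := fun x => x ^ ((k : ℝ) - 1) * Real.exp (-B * x ^ (1 / τ)) with hF
  have hk1 : (1 : ℝ) ≤ k := by exact_mod_cast hk
  have hFint : IntegrableOn F (Set.Ioi 0) := by
    -- The integral of a non-integrable function is `0` by convention, whereas the Gamma formula
    -- gives a positive value; hence the function is integrable.
    by_contra hcon
    have h1 := integral_undef hcon
    have h2 := integral_rpow_mul_exp_neg_mul_rpow (p := 1 / τ) (q := (k : ℝ) - 1) (b := B)
      (by positivity) (by linarith) hB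
    rw [h1] at h2
    have : 0 < Real.Gamma (((k : ℝ) - 1 + 1) / (1 / τ)) := Real.Gamma_pos_of_pos (by
      have : (0 : ℝ) < k := by linarith
      simp only [sub_add_cancel]
      positivity)
    have : 0 < B ^ (-((k : ℝ) - 1 + 1) / (1 / τ)) * (1 / (1 / τ)) *
      Real.Gamma (((k : ℝ) - 1 + 1) / (1 / τ)) := by positivity
    linarith
  set J := ∫ x in Set.Ioi 0, F x with hJ
  have hFnn : ∀ x ∈ Set.Ioi (0 : ℝ), 0 ≤ F x := fun x hx =>
    mul_nonneg (Real.rpow_nonneg (le_of_lt hx) _) (Real.exp_nonneg _)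
  have hJnn : 0 ≤ J := setIntegral_nonneg measurableSet_Ioi hFnn
  have hlin : ∀ d, ∫⁻ z, ENNReal.ofReal (z ^ k) ∂(ν d) ≤ ENNReal.ofReal (k * (A * J)) := by
    intro d
    have h1 : ∀ z : ℝ, z ^ k = |z| ^ (k : ℝ) := fun z => by
      rw [Real.rpow_natCast, hk2.pow_abs]
    simp_rw [h1]
    -- Layer-cake formula: the moment becomes an integral of the tail, to which the bound uniform in
    -- `d` applies.
    rw [lintegral_rpow_eq_lintegral_meas_le_mul (ν d) (Eventually.of_forall fun z => abs_nonneg z)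
      (by fun_prop) (by linarith : (0 : ℝ) < k), ENNReal.ofReal_mul (by positivity)]
    refine mul_le_mul_right ?_ _
    rw [hJ, ← integral_const_mul, ofReal_integral_eq_lintegral_ofReal (hFint.const_mul A)
      ((ae_restrict_iff' measurableSet_Ioi).2 (Eventually.of_forall fun x hx =>
        mul_nonneg hA.le (hFnn x hx)))]
    refine setLIntegral_mono' measurableSet_Ioi fun x hx => ?_
    calc _ ≤ ENNReal.ofReal (A * Real.exp (-B * x ^ (1 / τ))) *
          ENNReal.ofReal (x ^ ((k : ℝ) - 1)) := mul_le_mul_left (h d x hx) _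
      _ = _ := by
          rw [← ENNReal.ofReal_mul (by positivity), hF]
          congr 1
          ring
  refine ⟨k * (A * J), fun d => ?_⟩
  have hmeas : AEStronglyMeasurable (fun z : ℝ => z ^ k) (ν d) := by fun_prop
  have hnn : 0 ≤ᵐ[ν d] fun z : ℝ => z ^ k := Eventually.of_forall fun z => hk2.pow_nonneg z
  have hint : Integrable (fun z : ℝ => z ^ k) (ν d) := by
    refine ⟨hmeas, ?_⟩
    rw [hasFiniteIntegral_iff_ofReal hnn]
    exact (hlin d).trans_lt ENNReal.ofReal_lt_top
  refine ⟨hint, ?_⟩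
  rw [integral_eq_lintegral_of_nonneg_ae hnn hmeas]
  exact ENNReal.toReal_le_of_le_ofReal (by positivity) (hlin d)

/-- The fourth moment of `‖x‖² / d` for a standard Gaussian vector `x` of dimension `d`. -/
lemma integralLE_norm_sq_div_pow {d : ℕ} (hd : 1 ≤ d) :
    IntegralLE (fun x : E d => (‖x‖ ^ 2 / d) ^ 4) (stdGaussian (E d)) (∫ z, z ^ 8 ∂gauss) := by
  have hd0 : (0 : ℝ) < d := by exact_mod_cast hd
  have hcoord : ∀ i : Fin d, IntegralLE (fun x : E d => x i ^ 8) (stdGaussian (E d))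
      (∫ z, z ^ 8 ∂gauss) := by
    intro i
    have h := map_inner_stdGaussian (w := (EuclideanSpace.single i (1 : ℝ) : E d)) (by simp)
    have h2 := IntegralLE.of_map (f := fun z : ℝ => z ^ 8) h (by fun_prop)
      ⟨integrable_pow_gaussian 8, le_rfl⟩
    refine ⟨h2.1.congr (Eventually.of_forall fun x => ?_), le_of_eq_of_le
      (integral_congr_ae (Eventually.of_forall fun x => ?_)) h2.2⟩
    · simp [EuclideanSpace.inner_single_right]
    · simp [EuclideanSpace.inner_single_right]
  have hsum : IntegralLE (fun x : E d => (d : ℝ)⁻¹ * ∑ i, x i ^ 8) (stdGaussian (E d))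
      (∫ z, z ^ 8 ∂gauss) := by
    have hi : Integrable (fun x : E d => ∑ i, x i ^ 8) (stdGaussian (E d)) :=
      integrable_finsetSum _ fun i _ => (hcoord i).1
    refine ⟨hi.const_mul _, ?_⟩
    rw [integral_const_mul, integral_finsetSum _ fun i _ => (hcoord i).1]
    have : ∑ i : Fin d, ∫ x : E d, x i ^ 8 ∂(stdGaussian (E d)) ≤
        ∑ _i : Fin d, ∫ z, z ^ 8 ∂gauss := Finset.sum_le_sum fun i _ => (hcoord i).2
    rw [Finset.sum_const, Finset.card_univ, Fintype.card_fin, nsmul_eq_mul] at this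
    rwa [inv_mul_le_iff₀ hd0]
  refine hsum.mono (by fun_prop) fun x => ?_
  rw [abs_of_nonneg (by positivity)]
  -- By the power mean inequality the fourth power of the average of the `x_i²` is at most the
  -- average of the `x_i⁸`.
  have h := pow_sum_div_card_le_sum_pow (s := Finset.univ) (f := fun i : Fin d => x i ^ 2)
    (fun i _ => sq_nonneg _) 3
  rw [Finset.card_univ, Fintype.card_fin] at h
  simp_rw [← pow_mul] at h
  norm_num at h
  rw [EuclideanSpace.real_norm_sq_eq, div_pow]
  calc (∑ i, x i ^ 2) ^ 4 / (d : ℝ) ^ 4 = (d : ℝ)⁻¹ * ((∑ i, x i ^ 2) ^ 4 / (d : ℝ) ^ 3) := by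
        field_simp
    _ ≤ _ := by gcongr

/-- A function that dominates all the quantities that occur in a step of the iteration. -/
noncomputable def stepWeight {d : ℕ} (σs : ℝ → ℝ) (σ : ℝ[X]) (θ w : E d) (s : E d × ℝ) : ℝ :=
  1 + label σs θ s ^ 16 + σ.derivative.eval (inner ℝ s.1 w) ^ 16 + (inner ℝ s.1 θ) ^ 4 +
    (inner ℝ s.1 w) ^ 4 + (‖s.1‖ ^ 2 / d) ^ 4

lemma measurable_label {d : ℕ} {σs : ℝ → ℝ} (hm : Measurable σs) (θ : E d) :
    Measurable (label σs θ) := by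
  unfold label
  have : Measurable fun s : E d × ℝ => (inner ℝ s.1 θ : ℝ) := by fun_prop
  exact (hm.comp this).add measurable_snd

/-- The constant is free of `d`: apart from the constant `1`, each summand is controlled by
one-dimensional standard Gaussian marginals, by the uniformly bounded noise moments, or by the
normalised quantity `‖x‖² / d`. -/
lemma exists_integralLE_stepWeight {σs : ℝ → ℝ} (hm : Measurable σs)
    (hg : PolynomialGrowth σs) (σ : ℝ[X]) {ν : ℕ → Measure ℝ} [∀ d, IsProbabilityMeasure (ν d)]
    (hν : UniformlySubWeibull ν) :
    ∃ C : ℝ, ∀ d : ℕ, 1 ≤ d → ∀ θ w : E d, ‖θ‖ = 1 → ‖w‖ = 1 →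
      IntegralLE (stepWeight σs σ θ w) ((stdGaussian (E d)).prod (ν d)) C := by
  obtain ⟨Cν, hCν⟩ := hν.exists_moment_le (k := 16) (by norm_num) (by decide)
  refine ⟨1 + 2 ^ 15 * ((∫ z, σs z ^ 16 ∂gauss) + Cν) + (∫ z, σ.derivative.eval z ^ 16 ∂gauss) +
    (∫ z, z ^ 4 ∂gauss) + (∫ z, z ^ 4 ∂gauss) + ∫ z, z ^ 8 ∂gauss, fun d hd θ w hθ hw => ?_⟩
  have hmθ : Measurable fun x : E d => (inner ℝ x θ : ℝ) := by fun_prop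
  have hmw : Measurable fun x : E d => (inner ℝ x w : ℝ) := by fun_prop
  have h1 : IntegralLE (fun _ : E d × ℝ => (1 : ℝ)) ((stdGaussian (E d)).prod (ν d)) 1 :=
    ⟨integrable_const _, by simp⟩
  have hσ := (IntegralLE.of_map (f := fun z => σs z ^ 16) (map_inner_stdGaussian hθ) hmθ
    ⟨hg.integrable_pow hm 16, le_rfl⟩).comp_fst (ν d)
  have hlab : IntegralLE (fun s => label σs θ s ^ 16) ((stdGaussian (E d)).prod (ν d))
      (2 ^ 15 * ((∫ z, σs z ^ 16 ∂gauss) + Cν)) := by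
    refine ((hσ.add ((hCν d).comp_snd (stdGaussian (E d)))).const_mul
      (a := 2 ^ 15) (by norm_num)).mono
      ((measurable_label hm θ).pow_const 16).aestronglyMeasurable fun s => ?_
    rw [abs_of_nonneg (by positivity)]
    exact Even.add_pow_le (by decide)
  have hP := (IntegralLE.of_map (f := fun z => σ.derivative.eval z ^ 16)
    (map_inner_stdGaussian hw) hmw ⟨by
      refine (integrable_eval_gaussian (σ.derivative ^ 16)).congr
        (Eventually.of_forall fun z => ?_)
      simp, le_rfl⟩).comp_fst (ν d)
  have h4θ := (IntegralLE.of_map (f := fun z => z ^ 4)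
    (map_inner_stdGaussian hθ) hmθ ⟨integrable_pow_gaussian 4, le_rfl⟩).comp_fst (ν d)
  have h4w := (IntegralLE.of_map (f := fun z => z ^ 4)
    (map_inner_stdGaussian hw) hmw ⟨integrable_pow_gaussian 4, le_rfl⟩).comp_fst (ν d)
  have hnorm := (integralLE_norm_sq_div_pow hd).comp_fst (ν d)
  exact ((((h1.add hlab).add hP).add h4θ).add h4w).add hnorm

end Moments

/-! ### One step of the iteration, pointwise -/

section Step

variable {d : ℕ}

/-- The component along `θ` of the (negative) spherical gradient. -/
noncomputable def gradAlign (σs : ℝ → ℝ) (σ : ℝ[X]) (θ w : E d) (s : E d × ℝ) : ℝ :=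
  label σs θ s * σ.derivative.eval (inner ℝ s.1 w) *
    (inner ℝ s.1 θ - inner ℝ θ w * inner ℝ s.1 w)

/-- The squared norm of the spherical gradient. -/
noncomputable def gradSq (σs : ℝ → ℝ) (σ : ℝ[X]) (θ w : E d) (s : E d × ℝ) : ℝ :=
  (label σs θ s * σ.derivative.eval (inner ℝ s.1 w)) ^ 2 * ‖tangentProj w s.1‖ ^ 2

/-- The change of the alignment in one step of the iteration. -/
noncomputable def increment (σs : ℝ → ℝ) (σ : ℝ[X]) (γ : ℝ) (θ w : E d) (s : E d × ℝ) : ℝ :=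
  inner ℝ θ (sgdStep σ γ w s.1 (label σs θ s)) - inner ℝ θ w

lemma inner_tangentProj_self {w : E d} (hw : ‖w‖ = 1) (x : E d) :
    (inner ℝ w (tangentProj w x) : ℝ) = 0 := by
  simp [tangentProj, inner_sub_right, inner_smul_right, hw]

lemma norm_add_smul_tangentProj_sq {w : E d} (hw : ‖w‖ = 1) (x : E d) (η : ℝ) :
    ‖w + η • tangentProj w x‖ ^ 2 = 1 + η ^ 2 * ‖tangentProj w x‖ ^ 2 := by
  rw [norm_add_sq_real, inner_smul_right, inner_tangentProj_self hw, hw, norm_smul, mul_pow,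
    Real.norm_eq_abs, sq_abs]
  ring

lemma one_le_norm_add_smul_tangentProj {w : E d} (hw : ‖w‖ = 1) (x : E d) (η : ℝ) :
    1 ≤ ‖w + η • tangentProj w x‖ := by
  have h := norm_add_smul_tangentProj_sq hw x η
  have : 0 ≤ η ^ 2 * ‖tangentProj w x‖ ^ 2 := by positivity
  nlinarith [norm_nonneg (w + η • tangentProj w x)]

lemma norm_sgdStep (σ : ℝ[X]) (γ : ℝ) {w : E d} (hw : ‖w‖ = 1) (x : E d) (y : ℝ) :
    ‖sgdStep σ γ w x y‖ = 1 := by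
  have h := one_le_norm_add_smul_tangentProj hw x (γ * y * σ.derivative.eval (inner ℝ x w))
  rw [sgdStep, norm_smul, norm_inv, norm_norm, inv_mul_cancel₀ (by linarith)]

lemma norm_tangentProj_sq_le {w : E d} (hw : ‖w‖ = 1) (x : E d) :
    ‖tangentProj w x‖ ^ 2 ≤ ‖x‖ ^ 2 := by
  rw [tangentProj, norm_sub_sq_real, inner_smul_right, norm_smul, hw, real_inner_comm w x,
    Real.norm_eq_abs, mul_one, sq_abs]
  nlinarith [sq_nonneg (inner ℝ x w : ℝ)]

/-- Here `n` is the norm before normalisation; the update is orthogonal to `w`, so Pythagoras gives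
`n²`. -/
lemma exists_increment_eq (σs : ℝ → ℝ) (σ : ℝ[X]) (γ : ℝ) {θ w : E d} (hw : ‖w‖ = 1)
    (s : E d × ℝ) : ∃ n : ℝ, 1 ≤ n ∧ n ^ 2 = 1 + γ ^ 2 * gradSq σs σ θ w s ∧
      increment σs σ γ θ w s = n⁻¹ * (inner ℝ θ w + γ * gradAlign σs σ θ w s) - inner ℝ θ w := by
  set η := γ * label σs θ s * σ.derivative.eval (inner ℝ s.1 w) with hη
  refine ⟨‖w + η • tangentProj w s.1‖, one_le_norm_add_smul_tangentProj hw _ _, ?_, ?_⟩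
  · rw [norm_add_smul_tangentProj_sq hw, gradSq, hη]
    ring
  · rw [increment, sgdStep, inner_smul_right, inner_add_right, inner_smul_right, tangentProj,
      inner_sub_right, inner_smul_right, gradAlign, hη, real_inner_comm s.1 θ,
      real_inner_comm s.1 w]
    ring

lemma one_sub_inv_le {n X : ℝ} (hn : 1 ≤ n) (h : n ^ 2 = 1 + X) :
    0 ≤ 1 - n⁻¹ ∧ 1 - n⁻¹ ≤ X / 2 := by
  have h0 : 0 < n := by linarith
  constructor
  · rw [sub_nonneg]
    exact inv_le_one_of_one_le₀ hn
  · have : X = n ^ 2 - 1 := by linarith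
    rw [this, ← sub_nonneg]
    have h1 : (n ^ 2 - 1) / 2 - (1 - n⁻¹) = (n - 1) * (n * (n + 1) - 2) / (2 * n) := by
      field_simp
      ring
    rw [h1]
    have : 0 ≤ n * (n + 1) - 2 := by nlinarith
    have : 0 ≤ n - 1 := by linarith
    positivity

lemma abs_inner_le_one {θ w : E d} (hθ : ‖θ‖ = 1) (hw : ‖w‖ = 1) : |(inner ℝ θ w : ℝ)| ≤ 1 := by
  have := abs_real_inner_le_norm θ w
  rwa [hθ, hw, mul_one] at this

lemma gradSq_nonneg (σs : ℝ → ℝ) (σ : ℝ[X]) (θ w : E d) (s : E d × ℝ) :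
    0 ≤ gradSq σs σ θ w s := by
  unfold gradSq
  positivity

/-- Normalisation multiplies `κ + γ G` by `1/n`, and `1 - 1/n` is of second order in `γ`. The order
`γ²` error therefore carries a factor `|κ|`, without which it could swamp the drift near
initialisation. -/
lemma abs_increment_sub_le (σs : ℝ → ℝ) (σ : ℝ[X]) {γ : ℝ} (hγ : 0 ≤ γ) {θ w : E d}
    (hw : ‖w‖ = 1) (s : E d × ℝ) :
    |increment σs σ γ θ w s - γ * gradAlign σs σ θ w s| ≤
      |(inner ℝ θ w : ℝ)| * γ ^ 2 / 2 * gradSq σs σ θ w s +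
        γ ^ 3 / 2 * (|gradAlign σs σ θ w s| * gradSq σs σ θ w s) := by
  obtain ⟨n, hn, hn2, hinc⟩ := exists_increment_eq σs σ γ (θ := θ) hw s
  obtain ⟨h0, h1⟩ := one_sub_inv_le hn hn2
  rw [hinc]
  set κ : ℝ := inner ℝ θ w
  set G := gradAlign σs σ θ w s
  set N := gradSq σs σ θ w s
  have : n⁻¹ * (κ + γ * G) - κ - γ * G = -((κ + γ * G) * (1 - n⁻¹)) := by ring
  rw [this, abs_neg, abs_mul, abs_of_nonneg h0]
  have h2 : |κ + γ * G| ≤ |κ| + γ * |G| := by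
    refine (abs_add_le _ _).trans ?_
    rw [abs_mul, abs_of_nonneg hγ]
  calc |κ + γ * G| * (1 - n⁻¹) ≤ (|κ| + γ * |G|) * (γ ^ 2 * N / 2) := by gcongr
    _ = _ := by ring

lemma increment_sq_le (σs : ℝ → ℝ) (σ : ℝ[X]) (γ : ℝ) {θ w : E d} (hθ : ‖θ‖ = 1)
    (hw : ‖w‖ = 1) (s : E d × ℝ) :
    increment σs σ γ θ w s ^ 2 ≤
      2 * γ ^ 2 * gradAlign σs σ θ w s ^ 2 + γ ^ 4 / 2 * gradSq σs σ θ w s ^ 2 := by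
  obtain ⟨n, hn, hn2, hinc⟩ := exists_increment_eq σs σ γ (θ := θ) hw s
  obtain ⟨h0, h1⟩ := one_sub_inv_le hn hn2
  have hκ := abs_inner_le_one hθ hw
  rw [hinc]
  set κ : ℝ := inner ℝ θ w
  set G := gradAlign σs σ θ w s
  set N := gradSq σs σ θ w s
  have hn0 : 0 < n := by linarith
  have hinv : n⁻¹ ≤ 1 := by linarith
  have hinv0 : 0 ≤ n⁻¹ := by positivity
  have e : n⁻¹ * (κ + γ * G) - κ = n⁻¹ * (γ * G) + -(κ * (1 - n⁻¹)) := by ring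
  have ha : (n⁻¹ * (γ * G)) ^ 2 ≤ (γ * G) ^ 2 := by
    rw [mul_pow]
    exact mul_le_of_le_one_left (sq_nonneg _) (pow_le_one₀ hinv0 hinv)
  have hb : (κ * (1 - n⁻¹)) ^ 2 ≤ (γ ^ 2 * N / 2) ^ 2 := by
    rw [mul_pow]
    calc κ ^ 2 * (1 - n⁻¹) ^ 2 ≤ 1 * (γ ^ 2 * N / 2) ^ 2 := by
          gcongr
          exact (sq_le_one_iff_abs_le_one κ).2 hκ
      _ = _ := one_mul _
  rw [e]
  calc (n⁻¹ * (γ * G) + -(κ * (1 - n⁻¹))) ^ 2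
      ≤ 2 * ((n⁻¹ * (γ * G)) ^ 2 + (-(κ * (1 - n⁻¹))) ^ 2) := add_sq_le
    _ ≤ 2 * ((γ * G) ^ 2 + (γ ^ 2 * N / 2) ^ 2) := by rw [neg_sq]; gcongr
    _ = _ := by ring

lemma prod_sq_le (y h : ℝ) : (y * h) ^ 4 ≤ (1 + y ^ 16 + h ^ 16) / 2 := by
  have h1 : (y * h) ^ 4 ≤ (y ^ 8 + h ^ 8) / 2 := by nlinarith [sq_nonneg (y ^ 4 - h ^ 4)]
  have h2 : y ^ 8 ≤ (1 + y ^ 16) / 2 := by nlinarith [sq_nonneg (y ^ 8 - 1)]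
  have h3 : h ^ 8 ≤ (1 + h ^ 16) / 2 := by nlinarith [sq_nonneg (h ^ 8 - 1)]
  have h4 : 0 ≤ y ^ 16 := by positivity
  have h5 : 0 ≤ h ^ 16 := by positivity
  linarith

/-- Only the marginals of `x` along `θ` and `w` enter, so no factor `d` appears, in contrast with
`gradSq`. -/
lemma gradAlign_sq_le (σs : ℝ → ℝ) (σ : ℝ[X]) {θ w : E d} (hθ : ‖θ‖ = 1)
    (hw : ‖w‖ = 1) (s : E d × ℝ) :
    gradAlign σs σ θ w s ^ 2 ≤ 5 * stepWeight σs σ θ w s := by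
  have hκ := abs_inner_le_one hθ hw
  unfold gradAlign stepWeight
  set κ : ℝ := inner ℝ θ w
  set y := label σs θ s
  set h := σ.derivative.eval (inner ℝ s.1 w)
  set v : ℝ := inner ℝ s.1 θ
  set u : ℝ := inner ℝ s.1 w
  have h1 := prod_sq_le y h
  have h2 : (v - κ * u) ^ 4 ≤ 8 * (v ^ 4 + u ^ 4) := by
    have h3 : (v + -(κ * u)) ^ 4 ≤ 2 ^ (4 - 1) * (v ^ 4 + (-(κ * u)) ^ 4) :=
      Even.add_pow_le (by decide)
    have h4 : (-(κ * u)) ^ 4 ≤ u ^ 4 := by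
      have e : (-(κ * u)) ^ 4 = |κ| ^ 4 * u ^ 4 := by
        rw [Even.pow_abs (by decide)]
        ring
      rw [e]
      exact mul_le_of_le_one_left (by positivity) (pow_le_one₀ (abs_nonneg _) hκ)
    rw [sub_eq_add_neg]
    norm_num at h3
    linarith
  have h5 : (y * h * (v - κ * u)) ^ 2 ≤ ((y * h) ^ 4 + (v - κ * u) ^ 4) / 2 := by
    nlinarith [sq_nonneg ((y * h) ^ 2 - (v - κ * u) ^ 2)]
  have h6 : 0 ≤ (‖s.1‖ ^ 2 / d) ^ 4 := by positivity
  have h7 : 0 ≤ y ^ 16 := by positivity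
  have h8 : 0 ≤ h ^ 16 := by positivity
  have h9 : 0 ≤ v ^ 4 := by positivity
  have h10 : 0 ≤ u ^ 4 := by positivity
  linarith

lemma gradSq_le_mul (hd : 1 ≤ d) (σs : ℝ → ℝ) (σ : ℝ[X]) (θ : E d) {w : E d}
    (hw : ‖w‖ = 1) (s : E d × ℝ) :
    gradSq σs σ θ w s ≤ d * ((label σs θ s * σ.derivative.eval (inner ℝ s.1 w)) ^ 2 *
      (‖s.1‖ ^ 2 / d)) := by
  have hd0 : (0 : ℝ) < d := by exact_mod_cast hd
  have e : (d : ℝ) * ((label σs θ s * σ.derivative.eval (inner ℝ s.1 w)) ^ 2 *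
      (‖s.1‖ ^ 2 / d)) = (label σs θ s * σ.derivative.eval (inner ℝ s.1 w)) ^ 2 * ‖s.1‖ ^ 2 := by
    field_simp
  rw [e, gradSq]
  exact mul_le_mul_of_nonneg_left (norm_tangentProj_sq_le hw _) (sq_nonneg _)

lemma gradSq_le (hd : 1 ≤ d) (σs : ℝ → ℝ) (σ : ℝ[X]) (θ : E d) {w : E d}
    (hw : ‖w‖ = 1) (s : E d × ℝ) :
    gradSq σs σ θ w s ≤ d * stepWeight σs σ θ w s := by
  refine (gradSq_le_mul hd σs σ θ hw s).trans (mul_le_mul_of_nonneg_left ?_ (by positivity))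
  unfold stepWeight
  set y := label σs θ s
  set h := σ.derivative.eval (inner ℝ s.1 w)
  set v : ℝ := inner ℝ s.1 θ
  set u : ℝ := inner ℝ s.1 w
  set r : ℝ := ‖s.1‖ ^ 2 / d
  have h1 := prod_sq_le y h
  have h5 : (y * h) ^ 2 * r ≤ ((y * h) ^ 4 + r ^ 2) / 2 := by
    nlinarith [sq_nonneg ((y * h) ^ 2 - r)]
  have h6 : r ^ 2 ≤ (1 + r ^ 4) / 2 := by nlinarith [sq_nonneg (r ^ 2 - 1)]
  have h7 : 0 ≤ y ^ 16 := by positivity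
  have h8 : 0 ≤ h ^ 16 := by positivity
  have h9 : 0 ≤ v ^ 4 := by positivity
  have h10 : 0 ≤ u ^ 4 := by positivity
  have h11 : 0 ≤ r ^ 4 := by positivity
  linarith

/-- This bound dictates the powers in `stepWeight`: two applications of AM-GM to `(y h)⁴ r²` lead to
`y¹⁶`, `h¹⁶` and `r⁴`. -/
lemma gradSq_sq_le (hd : 1 ≤ d) (σs : ℝ → ℝ) (σ : ℝ[X]) (θ : E d) {w : E d}
    (hw : ‖w‖ = 1) (s : E d × ℝ) :
    gradSq σs σ θ w s ^ 2 ≤ (d : ℝ) ^ 2 * stepWeight σs σ θ w s := by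
  refine (pow_le_pow_left₀ (gradSq_nonneg σs σ θ w s) (gradSq_le_mul hd σs σ θ hw s) 2).trans ?_
  rw [mul_pow]
  refine mul_le_mul_of_nonneg_left ?_ (by positivity)
  unfold stepWeight
  set y := label σs θ s
  set h := σ.derivative.eval (inner ℝ s.1 w)
  set v : ℝ := inner ℝ s.1 θ
  set u : ℝ := inner ℝ s.1 w
  set r : ℝ := ‖s.1‖ ^ 2 / d
  have h1 : (y * h) ^ 8 ≤ (y ^ 16 + h ^ 16) / 2 := by nlinarith [sq_nonneg (y ^ 8 - h ^ 8)]
  have h5 : ((y * h) ^ 2 * r) ^ 2 ≤ ((y * h) ^ 8 + r ^ 4) / 2 := by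
    nlinarith [sq_nonneg ((y * h) ^ 4 - r ^ 2)]
  have h7 : 0 ≤ y ^ 16 := by positivity
  have h8 : 0 ≤ h ^ 16 := by positivity
  have h9 : 0 ≤ v ^ 4 := by positivity
  have h10 : 0 ≤ u ^ 4 := by positivity
  have h11 : 0 ≤ r ^ 4 := by positivity
  linarith

lemma abs_gradAlign_mul_gradSq_le (hd : 1 ≤ d) (σs : ℝ → ℝ) (σ : ℝ[X]) {θ w : E d}
    (hθ : ‖θ‖ = 1) (hw : ‖w‖ = 1) (s : E d × ℝ) :
    |gradAlign σs σ θ w s| * gradSq σs σ θ w s ≤ 3 * d * stepWeight σs σ θ w s := by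
  have hd0 : (0 : ℝ) < d := by exact_mod_cast hd
  have h1 := gradAlign_sq_le σs σ hθ hw s
  have h2 := gradSq_sq_le hd σs σ θ hw s
  set G := gradAlign σs σ θ w s
  set N := gradSq σs σ θ w s
  -- `N` is larger than `G` by a factor `d`; weighting AM-GM accordingly costs only one power of
  -- `d`.
  have h3 : d * (|G| * N) ≤ (d ^ 2 * G ^ 2 + N ^ 2) / 2 := by
    rw [← sq_abs G]
    nlinarith [sq_nonneg (d * |G| - N)]
  have h4 : (d : ℝ) ^ 2 * G ^ 2 ≤ (d : ℝ) ^ 2 * (5 * stepWeight σs σ θ w s) := by gcongr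
  have h5 : d * (|G| * N) ≤ d * (3 * d * stepWeight σs σ θ w s) := by nlinarith
  exact le_of_mul_le_mul_left h5 hd0

lemma measurable_inner_fst (w : E d) : Measurable fun s : E d × ℝ => (inner ℝ s.1 w : ℝ) := by
  fun_prop

lemma measurable_sgdStep {σs : ℝ → ℝ} (hm : Measurable σs) (σ : ℝ[X]) (γ : ℝ) (θ : E d) :
    Measurable (Function.uncurry fun (w : E d) (s : E d × ℝ) =>
      sgdStep σ γ w s.1 (label σs θ s)) := by
  unfold Function.uncurry sgdStep tangentProj
  have h1 : Measurable fun q : E d × (E d × ℝ) => label σs θ q.2 :=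
    (measurable_label hm θ).comp measurable_snd
  have h2 : Measurable fun q : E d × (E d × ℝ) => (inner ℝ q.2.1 q.1 : ℝ) := by fun_prop
  have h3 : Measurable fun q : E d × (E d × ℝ) => σ.derivative.eval (inner ℝ q.2.1 q.1) :=
    σ.derivative.continuous.measurable.comp h2
  have h4 : Measurable fun q : E d × (E d × ℝ) => q.2.1 - (inner ℝ q.1 q.2.1 : ℝ) • q.1 := by
    fun_prop
  have h5 := measurable_fst.add (((h1.const_mul γ).mul h3).smul h4)
  exact h5.norm.inv.smul h5

lemma measurable_increment {σs : ℝ → ℝ} (hm : Measurable σs) (σ : ℝ[X]) (γ : ℝ) (θ : E d) :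
    Measurable (Function.uncurry (increment σs σ γ θ)) := by
  have h := measurable_sgdStep hm σ γ θ
  unfold increment
  exact ((measurable_const.inner h)).sub (measurable_const.inner measurable_fst)

end Step

/-! ### The population drift and the second moment of a step -/

section Drift

variable {d : ℕ}

lemma gaussian_weight_bound (a h v u κ : ℝ) (hκ : |κ| ≤ 1) :
    |a * h * (v - κ * u)| ≤ 3 * (1 + a ^ 16 + h ^ 16 + v ^ 4 + u ^ 4) := by
  have h1 := prod_sq_le a h
  have hκ2 : κ ^ 2 ≤ 1 := (sq_le_one_iff_abs_le_one κ).2 hκ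
  have h2 : (v - κ * u) ^ 2 ≤ 2 * (v ^ 2 + u ^ 2) := by
    have : (κ * u) ^ 2 ≤ u ^ 2 := by
      rw [mul_pow]
      exact mul_le_of_le_one_left (sq_nonneg _) hκ2
    nlinarith [sq_nonneg (v + κ * u)]
  have h3 : |a * h * (v - κ * u)| ≤ ((a * h) ^ 2 + (v - κ * u) ^ 2) / 2 := by
    rw [abs_mul, ← sq_abs (a * h), ← sq_abs (v - κ * u)]
    nlinarith [sq_nonneg (|a * h| - |v - κ * u|)]
  have h4 : (a * h) ^ 2 ≤ (1 + (a * h) ^ 4) / 2 := by nlinarith [sq_nonneg ((a * h) ^ 2 - 1)]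
  have h5 : v ^ 2 ≤ (1 + v ^ 4) / 2 := by nlinarith [sq_nonneg (v ^ 2 - 1)]
  have h6 : u ^ 2 ≤ (1 + u ^ 4) / 2 := by nlinarith [sq_nonneg (u ^ 2 - 1)]
  have h7 : 0 ≤ a ^ 16 := by positivity
  have h8 : 0 ≤ h ^ 16 := by positivity
  have h9 : 0 ≤ v ^ 4 := by positivity
  have h10 : 0 ≤ u ^ 4 := by positivity
  linarith

lemma integrable_mul_eval_mul {g : ℝ → ℝ} (hm : Measurable g) (hg : PolynomialGrowth g)
    (P : ℝ[X]) {θ w : E d} (hθ : ‖θ‖ = 1) (hw : ‖w‖ = 1) :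
    Integrable (fun x : E d => g (inner ℝ x θ) * P.eval (inner ℝ x w) *
      (inner ℝ x θ - inner ℝ θ w * inner ℝ x w)) (stdGaussian (E d)) := by
  have hmθ : Measurable fun x : E d => (inner ℝ x θ : ℝ) := by fun_prop
  have hmw : Measurable fun x : E d => (inner ℝ x w : ℝ) := by fun_prop
  have key : ∀ {f : ℝ → ℝ} {w : E d}, ‖w‖ = 1 → Integrable f gauss →
      Integrable (fun x : E d => f (inner ℝ x w)) (stdGaussian (E d)) := fun hw hf =>
    (IntegralLE.of_map (map_inner_stdGaussian hw) (by fun_prop) ⟨hf, le_rfl⟩).1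
  have i1 := key hθ (hg.integrable_pow hm 16)
  have i2 := key hw (f := fun z => P.eval z ^ 16) ((integrable_eval_gaussian (P ^ 16)).congr
    (Eventually.of_forall fun z => by simp))
  have i3 := key hθ (integrable_pow_gaussian 4)
  have i4 := key hw (integrable_pow_gaussian 4)
  refine ((((((integrable_const (1 : ℝ)).add i1).add i2).add i3).add i4).const_mul 3).mono' ?_
    (Eventually.of_forall fun x =>
      gaussian_weight_bound _ _ _ _ _ (abs_inner_le_one hθ hw))
  exact (((hm.comp hmθ).mul (P.continuous.measurable.comp hmw)).mul
    (hmθ.sub (hmw.const_mul _))).aestronglyMeasurable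

/-- The population gradient for a single Hermite mode. -/
lemma integral_mul_hermiteReal_mul {g : ℝ → ℝ} (hm : Measurable g) (hg : PolynomialGrowth g)
    (j : ℕ) {θ w : E d} (hθ : ‖θ‖ = 1) (hw : ‖w‖ = 1) :
    ∫ x : E d, g (inner ℝ x θ) * (hermiteReal j).eval (inner ℝ x w) *
      (inner ℝ x θ - inner ℝ θ w * inner ℝ x w) ∂(stdGaussian (E d)) =
      (1 - (inner ℝ θ w) ^ 2) * (inner ℝ θ w) ^ j * hermiteCoeff g (j + 1) := by
  have hint := integrable_mul_eval_mul hm hg (hermiteReal j) hθ hw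
  have hκ := (sq_le_one_iff_abs_le_one _).2 (abs_inner_le_one hθ hw)
  set κ : ℝ := inner ℝ θ w with hκdef
  set s := Real.sqrt (1 - κ ^ 2)
  have hs : κ ^ 2 + s ^ 2 = 1 := by
    rw [Real.sq_sqrt (by linarith)]
    ring
  have hlaw := map_inner_inner_stdGaussian hθ hw hs
  set F : ℝ × ℝ → ℝ := fun q => g q.1 * (hermiteReal j).eval q.2 * (q.1 - κ * q.2) with hF
  have hFm : Measurable F := ((hm.comp measurable_fst).mul
    ((hermiteReal j).continuous.measurable.comp measurable_snd)).mul
      (measurable_fst.sub (measurable_snd.const_mul _))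
  have hφ : Measurable fun x : E d => ((inner ℝ x θ : ℝ), (inner ℝ x w : ℝ)) := by fun_prop
  have hψ : Measurable fun q : ℝ × ℝ => (q.1, κ * q.1 + s * q.2) := by fun_prop
  have hintF : Integrable F
      ((stdGaussian (E d)).map fun x => ((inner ℝ x θ : ℝ), (inner ℝ x w : ℝ))) :=
    (integrable_map_measure hFm.aestronglyMeasurable hφ.aemeasurable).2 hint
  rw [hlaw] at hintF
  have hint2 := (integrable_map_measure hFm.aestronglyMeasurable hψ.aemeasurable).1 hintF
  -- Condition on `v = ⟨x, θ⟩`: integrating out the independent part of `⟨x, w⟩` leaves a multiple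
  -- of `He_(j+1)(v)`, and pairing with `g` gives its Hermite coefficient.
  calc _ = ∫ q, F q ∂((stdGaussian (E d)).map
        fun x => ((inner ℝ x θ : ℝ), (inner ℝ x w : ℝ))) := by
        rw [integral_map hφ.aemeasurable hFm.aestronglyMeasurable]
    _ = ∫ q : ℝ × ℝ, F (q.1, κ * q.1 + s * q.2) ∂(gauss.prod gauss) := by
        rw [hlaw, integral_map hψ.aemeasurable hFm.aestronglyMeasurable]
    _ = ∫ v, ∫ z, F (v, κ * v + s * z) ∂gauss ∂gauss := integral_prod _ hint2
    _ = ∫ v, (1 - κ ^ 2) * κ ^ j * (g v * (hermiteReal (j + 1)).eval v) ∂gauss := by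
        refine integral_congr_ae (Eventually.of_forall fun v => ?_)
        simp only [hF]
        simp_rw [mul_assoc (g v)]
        rw [integral_const_mul, integral_hermiteReal_affine_mul hs]
        ring
    _ = _ := by
        rw [integral_const_mul, hermiteCoeff]
        simp_rw [aeval_hermite]

lemma integrable_id_of_integrable_pow {μ : Measure ℝ} [IsProbabilityMeasure μ]
    (h : Integrable (fun z : ℝ => z ^ 2) μ) : Integrable (fun z : ℝ => z) μ := by
  refine ((integrable_const (1 : ℝ)).add h).mono' (by fun_prop) (Eventually.of_forall fun z => ?_)
  simp only [Pi.add_apply, Real.norm_eq_abs]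
  rw [← sq_abs z]
  nlinarith [sq_nonneg (|z| - 1), sq_nonneg (|z|)]

lemma IsSymmetricLaw.integral_eq_zero {μ : Measure ℝ} (h : IsSymmetricLaw μ) :
    ∫ z, z ∂μ = 0 := by
  have h1 : ∫ z, z ∂(μ.map fun z => -z) = ∫ z, -z ∂μ :=
    integral_map (by fun_prop) (by fun_prop)
  rw [h, integral_neg] at h1
  linarith

lemma integrable_gradAlign {σs : ℝ → ℝ} (hm : Measurable σs) (hg : PolynomialGrowth σs)
    (σ : ℝ[X]) {μ : Measure ℝ} [IsProbabilityMeasure μ] (hμ : Integrable (fun z : ℝ => z) μ)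
    {θ w : E d} (hθ : ‖θ‖ = 1) (hw : ‖w‖ = 1) :
    Integrable (gradAlign σs σ θ w) ((stdGaussian (E d)).prod μ) := by
  have i1 := (integrable_mul_eval_mul hm hg σ.derivative hθ hw).comp_fst μ
  have i2 := (integrable_mul_eval_mul (g := fun _ => 1) measurable_const
    ⟨1, 1, one_pos, one_pos, fun z => by simp⟩ σ.derivative hθ hw).mul_prod hμ
  refine (i1.add i2).congr (Eventually.of_forall fun s => ?_)
  simp only [gradAlign, label, Pi.add_apply]
  ring

/-- The population gradient in terms of the Hermite expansion of the derivative of the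
activation. -/
lemma integral_gradAlign {σs : ℝ → ℝ} (hm : Measurable σs) (hg : PolynomialGrowth σs)
    (σ : ℝ[X]) {μ : Measure ℝ} [IsProbabilityMeasure μ] (hμ : Integrable (fun z : ℝ => z) μ)
    (hμs : IsSymmetricLaw μ) {n : ℕ} {β : ℕ → ℝ}
    (hσ : σ.derivative = ∑ j ∈ Finset.range n, Polynomial.C (β j) * hermiteReal j)
    {θ w : E d} (hθ : ‖θ‖ = 1) (hw : ‖w‖ = 1) :
    ∫ s, gradAlign σs σ θ w s ∂((stdGaussian (E d)).prod μ) =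
      (1 - (inner ℝ θ w) ^ 2) * ∑ j ∈ Finset.range n,
        β j * hermiteCoeff σs (j + 1) * (inner ℝ θ w) ^ j := by
  have i1 := (integrable_mul_eval_mul hm hg σ.derivative hθ hw)
  have i2 := (integrable_mul_eval_mul (g := fun _ => 1) measurable_const
    ⟨1, 1, one_pos, one_pos, fun z => by simp⟩ σ.derivative hθ hw)
  have e : ∀ s : E d × ℝ, gradAlign σs σ θ w s = σs (inner ℝ s.1 θ) *
      σ.derivative.eval (inner ℝ s.1 w) * (inner ℝ s.1 θ - inner ℝ θ w * inner ℝ s.1 w) +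
      1 * σ.derivative.eval (inner ℝ s.1 w) * (inner ℝ s.1 θ - inner ℝ θ w * inner ℝ s.1 w) *
        s.2 := by
    intro s
    simp only [gradAlign, label]
    ring
  simp_rw [e]
  -- The label noise enters linearly and is independent of `x`; by symmetry its mean is zero, so its
  -- term vanishes.
  rw [integral_add (i1.comp_fst μ) (i2.mul_prod hμ),
    integral_fun_fst (fun x : E d => σs (inner ℝ x θ) *
      σ.derivative.eval (inner ℝ x w) * (inner ℝ x θ - inner ℝ θ w * inner ℝ x w)),
    integral_prod_mul (fun x : E d =>
      1 * σ.derivative.eval (inner ℝ x w) * (inner ℝ x θ - inner ℝ θ w * inner ℝ x w))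
      (fun z : ℝ => z), hμs.integral_eq_zero]
  simp only [probReal_univ, one_smul, mul_zero, add_zero]
  have e2 : ∀ x : E d, σs (inner ℝ x θ) * σ.derivative.eval (inner ℝ x w) *
      (inner ℝ x θ - inner ℝ θ w * inner ℝ x w) = ∑ j ∈ Finset.range n, β j *
        (σs (inner ℝ x θ) * (hermiteReal j).eval (inner ℝ x w) *
          (inner ℝ x θ - inner ℝ θ w * inner ℝ x w)) := by
    intro x
    rw [hσ, Polynomial.eval_finsetSum, Finset.mul_sum, Finset.sum_mul]
    refine Finset.sum_congr rfl fun j _ => ?_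
    rw [Polynomial.eval_mul, Polynomial.eval_C]
    ring
  simp_rw [e2]
  rw [integral_finsetSum _ fun j _ => (integrable_mul_eval_mul hm hg _ hθ hw).const_mul _,
    Finset.mul_sum]
  refine Finset.sum_congr rfl fun j _ => ?_
  rw [integral_const_mul, integral_mul_hermiteReal_mul hm hg j hθ hw]
  ring

/-- The shape of the population drift as a function of the alignment. -/
lemma exists_drift_bounds {a : ℕ → ℝ} {n p : ℕ} (hp : 1 ≤ p) (ha : ∀ j, j + 1 < p → a j = 0)
    (hpos : 0 < a (p - 1)) (han : ∀ j, n ≤ j → a j = 0) :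
    ∃ C c δ : ℝ, 0 < C ∧ 0 < c ∧ 0 < δ ∧
      (∀ κ : ℝ, |κ| ≤ 1 →
        |(1 - κ ^ 2) * ∑ j ∈ Finset.range n, a j * κ ^ j| ≤ C * |κ| ^ (p - 1)) ∧
      (∀ κ : ℝ, 0 ≤ κ → κ ≤ δ →
        c * κ ^ (p - 1) ≤ (1 - κ ^ 2) * ∑ j ∈ Finset.range n, a j * κ ^ j) := by
  have hsplit : ∀ κ : ℝ, ∑ j ∈ Finset.range n, a j * κ ^ j =
      κ ^ (p - 1) * ∑ i ∈ Finset.range n, a (p - 1 + i) * κ ^ i := by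
    intro κ
    have h1 : ∑ j ∈ Finset.range n, a j * κ ^ j =
        ∑ j ∈ Finset.range (p - 1 + n), a j * κ ^ j := by
      refine Finset.sum_subset (Finset.range_mono (by omega)) fun j _ hj => ?_
      rw [han j (by simpa using hj), zero_mul]
    rw [h1, Finset.sum_range_add, Finset.mul_sum]
    have h2 : ∑ j ∈ Finset.range (p - 1), a j * κ ^ j = 0 :=
      Finset.sum_eq_zero fun j hj => by
        rw [ha j (by have := Finset.mem_range.1 hj; omega), zero_mul]
    rw [h2, zero_add]
    refine Finset.sum_congr rfl fun i _ => ?_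
    rw [pow_add]
    ring
  set F : ℝ → ℝ := fun κ => ∑ i ∈ Finset.range n, a (p - 1 + i) * κ ^ i with hF
  have hn : 0 < n := by
    by_contra h
    have := han (p - 1) (by omega)
    linarith
  have hF0 : F 0 = a (p - 1) := by
    simp only [hF]
    rw [Finset.sum_eq_single 0]
    · simp
    · intro i _ hi
      simp [hi]
    · intro h
      exact absurd (Finset.mem_range.2 hn) h
  have hcont : Continuous fun κ : ℝ => (1 - κ ^ 2) * F κ := by
    simp only [hF]
    fun_prop
  -- After the factor `κ^(p-1)` is removed, the drift is continuous with value `a (p - 1) > 0` at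
  -- `0`; half of this value serves as `c`.
  have hev : ∀ᶠ κ in 𝓝 (0 : ℝ), a (p - 1) / 2 < (1 - κ ^ 2) * F κ := by
    refine hcont.continuousAt.eventually (lt_mem_nhds ?_)
    simp only [hF0]
    norm_num
    linarith
  obtain ⟨δ, hδ, hball⟩ := Metric.eventually_nhds_iff.1 hev
  refine ⟨1 + ∑ i ∈ Finset.range n, |a (p - 1 + i)|, a (p - 1) / 2, δ / 2, ?_, by positivity,
    by positivity, ?_, ?_⟩
  · have := Finset.sum_nonneg fun i (_ : i ∈ Finset.range n) => abs_nonneg (a (p - 1 + i))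
    linarith
  · intro κ hκ
    have hκ2 : κ ^ 2 ≤ 1 := (sq_le_one_iff_abs_le_one κ).2 hκ
    have hFle : |F κ| ≤ 1 + ∑ i ∈ Finset.range n, |a (p - 1 + i)| := by
      refine (Finset.abs_sum_le_sum_abs _ _).trans ?_
      have : ∑ i ∈ Finset.range n, |a (p - 1 + i) * κ ^ i| ≤
          ∑ i ∈ Finset.range n, |a (p - 1 + i)| := by
        refine Finset.sum_le_sum fun i _ => ?_
        rw [abs_mul, abs_pow]
        exact mul_le_of_le_one_right (abs_nonneg _) (pow_le_one₀ (abs_nonneg _) hκ)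
      linarith
    rw [hsplit, abs_mul, abs_mul, abs_pow, abs_of_nonneg (by linarith : (0 : ℝ) ≤ 1 - κ ^ 2)]
    calc (1 - κ ^ 2) * (|κ| ^ (p - 1) * |F κ|)
        ≤ 1 * (|κ| ^ (p - 1) * (1 + ∑ i ∈ Finset.range n, |a (p - 1 + i)|)) := by
          gcongr
          linarith [sq_nonneg κ]
      _ = _ := by ring
  · intro κ h0 h1
    have := hball (y := κ) (by rw [Real.dist_eq, sub_zero, abs_of_nonneg h0]; linarith)
    rw [hsplit]
    have h2 : 0 ≤ κ ^ (p - 1) := by positivity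
    nlinarith

/-- The mean change of the alignment in one step of the iteration from `w`. -/
noncomputable def meanIncrement (σs : ℝ → ℝ) (σ : ℝ[X]) (μ : Measure ℝ) (γ : ℝ) (θ w : E d) : ℝ :=
  ∫ s, increment σs σ γ θ w s ∂((stdGaussian (E d)).prod μ)

/-- The first two moments of the change of the alignment in one step, uniformly in the
dimension. -/
theorem exists_increment_bounds {σs : ℝ → ℝ} (hm : Measurable σs) (hg : PolynomialGrowth σs)
    (σ : ℝ[X]) {ν : ℕ → Measure ℝ} [∀ d, IsProbabilityMeasure (ν d)]
    (hνs : ∀ d, IsSymmetricLaw (ν d)) (hν : UniformlySubWeibull ν) {p : ℕ}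
    (hp : IsInformationExponent σs p)
    (hpos : 0 < hermiteCoeff σs p * hermiteCoeff (fun z => σ.eval z) p) :
    ∃ C c δ : ℝ, 0 < C ∧ 0 < c ∧ 0 < δ ∧ ∀ d : ℕ, 1 ≤ d → ∀ γ : ℝ, 0 ≤ γ →
      ∀ θ w : E d, ‖θ‖ = 1 → ‖w‖ = 1 →
        MemLp (increment σs σ γ θ w) 2 ((stdGaussian (E d)).prod (ν d)) ∧
        ∫ s, increment σs σ γ θ w s ^ 2 ∂((stdGaussian (E d)).prod (ν d)) ≤
          C * (γ ^ 2 + γ ^ 4 * d ^ 2) ∧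
        |meanIncrement σs σ (ν d) γ θ w| ≤ C * (γ * |(inner ℝ θ w : ℝ)| ^ (p - 1) +
          |(inner ℝ θ w : ℝ)| * (γ ^ 2 * d) + γ ^ 3 * d) ∧
        (0 ≤ (inner ℝ θ w : ℝ) → (inner ℝ θ w : ℝ) ≤ δ →
          c * γ * (inner ℝ θ w) ^ (p - 1) - C * ((inner ℝ θ w) * (γ ^ 2 * d) + γ ^ 3 * d) ≤
            meanIncrement σs σ (ν d) γ θ w) := by
  obtain ⟨CW, hCW⟩ := exists_integralLE_stepWeight hm hg σ hν
  obtain ⟨C2, hC2⟩ := hν.exists_moment_le (k := 2) (by norm_num) (by decide)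
  obtain ⟨n, β, hσ, hβ, hβn⟩ := exists_derivative_eq_sum_hermiteReal σ
  have hp1 : 1 ≤ p := hp.1.1
  -- Minimality of `p` kills the coefficients below index `p - 1`. At `p - 1` positivity follows
  -- from `u_p(σ) = (p-1)! β_(p-1)`.
  obtain ⟨C1, c, δ, hC1, hc, hδ, hup, hlow⟩ := exists_drift_bounds (n := n) (p := p)
    (a := fun j => β j * hermiteCoeff σs (j + 1)) hp1
    (fun j hj => by
      have : hermiteCoeff σs (j + 1) = 0 := by
        by_contra hne
        have := hp.2 ⟨Nat.succ_pos j, hne⟩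
        omega
      simp [this])
    (by
      have h1 := hβ (p - 1)
      simp only [Nat.sub_add_cancel hp1] at h1 ⊢
      rw [h1] at hpos
      have h2 : (0 : ℝ) < (p - 1).factorial := by exact_mod_cast Nat.factorial_pos _
      have h3 : hermiteCoeff σs p * ((p - 1).factorial * β (p - 1)) =
        (p - 1).factorial * (β (p - 1) * hermiteCoeff σs p) := by ring
      rw [h3] at hpos
      exact pos_of_mul_pos_right hpos h2.le)
    (fun j hj => by simp [hβn j hj])
  have hCW0 : 0 ≤ |CW| := abs_nonneg _
  -- One constant serves all estimates: the second moment costs `10 |CW|`, the normalisation error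
  -- `2 |CW|`, the main drift `C1`.
  refine ⟨C1 + 11 * |CW|, c, δ, by positivity, hc, hδ, fun d hd γ hγ θ w hθ hw => ?_⟩
  have hd0 : (0 : ℝ) < d := by exact_mod_cast hd
  set μ := (stdGaussian (E d)).prod (ν d) with hμ
  have hW := hCW d hd θ w hθ hw
  have hW' : ∫ s, stepWeight σs σ θ w s ∂μ ≤ |CW| := hW.2.trans (le_abs_self _)
  have hνint := integrable_id_of_integrable_pow (hC2 d).1
  have hmeas : Measurable (increment σs σ γ θ w) :=
    (measurable_increment hm σ γ θ).of_uncurry_left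
  have hsqb : ∀ s, increment σs σ γ θ w s ^ 2 ≤
      (10 * (γ ^ 2 + γ ^ 4 * d ^ 2)) * stepWeight σs σ θ w s := by
    intro s
    refine (increment_sq_le σs σ γ hθ hw s).trans ?_
    have h1 := gradAlign_sq_le σs σ hθ hw s
    have h2 := gradSq_sq_le hd σs σ θ hw s
    have h3 : 2 * γ ^ 2 * gradAlign σs σ θ w s ^ 2 ≤
        2 * γ ^ 2 * (5 * stepWeight σs σ θ w s) := by gcongr
    have h4 : γ ^ 4 / 2 * gradSq σs σ θ w s ^ 2 ≤
        γ ^ 4 / 2 * ((d : ℝ) ^ 2 * stepWeight σs σ θ w s) := by gcongr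
    have h5 : 0 ≤ γ ^ 4 * ((d : ℝ) ^ 2 * stepWeight σs σ θ w s) :=
      mul_nonneg (by positivity) ((sq_nonneg _).trans h2)
    nlinarith
  have hsqint : Integrable (fun s => increment σs σ γ θ w s ^ 2) μ :=
    (hW.1.const_mul _).mono' (hmeas.pow_const 2).aestronglyMeasurable
      (Eventually.of_forall fun s => by
        rw [Real.norm_eq_abs, abs_of_nonneg (sq_nonneg _)]; exact hsqb s)
  have hmem : MemLp (increment σs σ γ θ w) 2 μ :=
    (memLp_two_iff_integrable_sq hmeas.aestronglyMeasurable).2 hsqint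
  have hGint : Integrable (gradAlign σs σ θ w) μ := integrable_gradAlign hm hg σ hνint hθ hw
  set κ : ℝ := inner ℝ θ w with hκdef
  have hκ : |κ| ≤ 1 := abs_inner_le_one hθ hw
  have hG := integral_gradAlign hm hg σ hνint (hνs d) hσ hθ hw
  rw [← hκdef] at hG
  have herr : |meanIncrement σs σ (ν d) γ θ w - γ * ∫ s, gradAlign σs σ θ w s ∂μ| ≤
      11 * |CW| * (|κ| * (γ ^ 2 * d) + γ ^ 3 * d) := by
    rw [meanIncrement, ← integral_const_mul, ← hμ,
      ← integral_sub (hmem.integrable (by norm_num)) (hGint.const_mul γ), ← Real.norm_eq_abs]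
    refine (norm_integral_le_of_norm_le
      (hW.1.const_mul (2 * (|κ| * (γ ^ 2 * d) + γ ^ 3 * d)))
      (Eventually.of_forall fun s => ?_)).trans ?_
    · rw [Real.norm_eq_abs]
      refine (abs_increment_sub_le σs σ hγ hw s).trans ?_
      have h1 := gradSq_le hd σs σ θ hw s
      have h2 := abs_gradAlign_mul_gradSq_le hd σs σ hθ hw s
      have hWnn : 0 ≤ stepWeight σs σ θ w s := by
        unfold stepWeight
        positivity
      have h3 : |κ| * γ ^ 2 / 2 * gradSq σs σ θ w s ≤
          |κ| * γ ^ 2 / 2 * (d * stepWeight σs σ θ w s) := by gcongr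
      have h4 : γ ^ 3 / 2 * (|gradAlign σs σ θ w s| * gradSq σs σ θ w s) ≤
          γ ^ 3 / 2 * (3 * d * stepWeight σs σ θ w s) := by gcongr
      have h5 : 0 ≤ |κ| * γ ^ 2 * (d * stepWeight σs σ θ w s) := by positivity
      have h6 : 0 ≤ γ ^ 3 * (d * stepWeight σs σ θ w s) := by positivity
      linarith
    · rw [integral_const_mul]
      have h1 : 0 ≤ |κ| * (γ ^ 2 * d) + γ ^ 3 * d := by positivity
      calc _ ≤ 2 * (|κ| * (γ ^ 2 * d) + γ ^ 3 * d) * |CW| := by gcongr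
        _ ≤ _ := by nlinarith [mul_nonneg h1 hCW0]
  have hX : 0 ≤ |κ| * (γ ^ 2 * d) + γ ^ 3 * d := by positivity
  refine ⟨hmem, ?_, ?_, ?_⟩
  · calc _ ≤ ∫ s, (10 * (γ ^ 2 + γ ^ 4 * d ^ 2)) * stepWeight σs σ θ w s ∂μ :=
          integral_mono hsqint (hW.1.const_mul _) hsqb
      _ = (10 * (γ ^ 2 + γ ^ 4 * d ^ 2)) * ∫ s, stepWeight σs σ θ w s ∂μ :=
          integral_const_mul _ _
      _ ≤ (10 * (γ ^ 2 + γ ^ 4 * d ^ 2)) * |CW| := by gcongr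
      _ ≤ _ := by
          have h1 : 0 ≤ γ ^ 2 + γ ^ 4 * (d : ℝ) ^ 2 := by positivity
          nlinarith [mul_nonneg h1 hCW0, mul_nonneg h1 hC1.le]
  · have h1 := hup κ hκ
    rw [← hG] at h1
    have h2 : |γ * ∫ s, gradAlign σs σ θ w s ∂μ| ≤ γ * (C1 * |κ| ^ (p - 1)) := by
      rw [abs_mul, abs_of_nonneg hγ]
      gcongr
    have h3 := abs_sub_abs_le_abs_sub (meanIncrement σs σ (ν d) γ θ w)
      (γ * ∫ s, gradAlign σs σ θ w s ∂μ)
    have h4 : 0 ≤ γ * |κ| ^ (p - 1) := by positivity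
    nlinarith [mul_nonneg h4 hCW0, mul_nonneg hX hC1.le]
  · intro h0 h1
    have h2 := hlow κ h0 h1
    rw [← hG] at h2
    have h3 : γ * (c * κ ^ (p - 1)) ≤ γ * ∫ s, gradAlign σs σ θ w s ∂μ := by gcongr
    have h4 := (abs_le.1 herr).1
    rw [abs_of_nonneg h0] at h4 hX
    nlinarith [mul_nonneg hX hC1.le]

end Drift

/-! ### Deterministic trajectories with drift and bounded noise -/

section Trajectories

variable {κ D M : ℕ → ℝ}

/-- A process with small drift and small noise stays in a small interval. -/
lemma abs_le_of_small_drift (h : ∀ t, κ t = κ 0 + ∑ s ∈ Finset.range t, D s + M t) {R β : ℝ}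
    {n : ℕ} (h0 : |κ 0| ≤ R / 2) (hM : ∀ t ≤ n, |M t| ≤ R / 8) (hβ : 0 ≤ β)
    (hD : ∀ s, |κ s| ≤ R → |D s| ≤ β) (hn : n * β ≤ R / 4) : ∀ t ≤ n, |κ t| ≤ R := by
  intro t
  induction t using Nat.strong_induction_on with
  | _ t ih =>
  intro ht
  have hR : 0 ≤ R := by linarith [abs_nonneg (κ 0)]
  have h1 : |∑ s ∈ Finset.range t, D s| ≤ n * β := by
    refine (Finset.abs_sum_le_sum_abs _ _).trans ?_
    calc ∑ s ∈ Finset.range t, |D s| ≤ ∑ _s ∈ Finset.range t, β :=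
          Finset.sum_le_sum fun s hs => hD s (ih s (Finset.mem_range.1 hs)
            ((Finset.mem_range.1 hs).le.trans ht))
      _ = t * β := by simp
      _ ≤ n * β := by gcongr
  rw [h t]
  have h2 := abs_add_le (κ 0 + ∑ s ∈ Finset.range t, D s) (M t)
  have h3 := abs_add_le (κ 0) (∑ s ∈ Finset.range t, D s)
  -- The shares `R/2` (start), `R/4` (drift) and `R/8` (noise) add up to less than `R`, which closes
  -- the bootstrap.
  linarith [hM t ht]

/-- A process with linearly growing drift and small noise exceeds `δ`. -/
lemma exists_gt_of_linear_drift (h : ∀ t, κ t = κ 0 + ∑ s ∈ Finset.range t, D s + M t)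
    {δ l : ℝ} {n : ℕ} (h0 : 0 < κ 0) (hM : ∀ t ≤ n, |M t| ≤ κ 0 / 2) (hl : 0 ≤ l)
    (hD : ∀ s, κ 0 / 2 ≤ κ s → κ s ≤ δ → l * κ s ≤ D s) (hκ : κ n ≤ 1)
    (hn : 1 < κ 0 / 2 * (1 + l) ^ n) : ∃ t ≤ n, δ < κ t := by
  by_contra! hcon
  -- A discrete Grönwall lower bound: the noise consumes at most half of `κ 0`, and the drift
  -- compounds on the other half. At `t = n` it would exceed `1`.
  have key : ∀ t ≤ n, κ 0 / 2 * (1 + l) ^ t ≤ κ t := by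
    intro t
    induction t using Nat.strong_induction_on with
    | _ t ih =>
    intro ht
    have h1 : ∑ s ∈ Finset.range t, l * (κ 0 / 2 * (1 + l) ^ s) ≤ ∑ s ∈ Finset.range t, D s := by
      refine Finset.sum_le_sum fun s hs => ?_
      have hst := Finset.mem_range.1 hs
      have h2 := ih s hst (hst.le.trans ht)
      have h3 : κ 0 / 2 ≤ κ s := by
        refine le_trans ?_ h2
        exact le_mul_of_one_le_right (by linarith) (one_le_pow₀ (by linarith))
      exact (mul_le_mul_of_nonneg_left h2 hl).trans (hD s h3 (hcon s (hst.le.trans ht)))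
    have h4 : ∑ s ∈ Finset.range t, l * (κ 0 / 2 * (1 + l) ^ s) =
        κ 0 / 2 * ((1 + l) ^ t - 1) := by
      have h5 := geom_sum_mul (1 + l) t
      rw [add_sub_cancel_left] at h5
      rw [← h5, Finset.sum_mul, Finset.mul_sum]
      refine Finset.sum_congr rfl fun s _ => ?_
      ring
    rw [h4] at h1
    have h6 := (abs_le.1 (hM t ht)).1
    rw [h t]
    linarith
  linarith [key n le_rfl]

/-- A process with nonnegative drift below `δ`, small drift and small noise does not return below
`δ / 2` after it has exceeded `δ`. -/
lemma half_le_of_nonneg_drift (h : ∀ t, κ t = κ 0 + ∑ s ∈ Finset.range t, D s + M t)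
    {δ : ℝ} {n t₀ : ℕ} (hM : ∀ t ≤ n, |M t| ≤ δ / 8) (ht₀ : t₀ ≤ n) (hκ : δ < κ t₀)
    (hD : ∀ s, δ / 2 ≤ κ s → κ s ≤ δ → 0 ≤ D s) (hD' : ∀ s, |D s| ≤ δ / 8) : δ / 2 ≤ κ n := by
  -- The invariant concerns `κ - M`, which changes only by the drift. If `κ ≤ δ`, then `κ ≥ 5δ/8 -
  -- δ/8 = δ/2` and the drift is nonnegative; if `κ > δ`, then `κ - M > 7δ/8` and one step loses at
  -- most `δ/8`.
  have key : ∀ t, t₀ ≤ t → t ≤ n → 5 * δ / 8 ≤ κ t - M t := by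
    intro t ht
    induction t, ht using Nat.le_induction with
    | base =>
      intro hn
      linarith [(abs_le.1 (hM t₀ hn)).2, abs_nonneg (M t₀), hM t₀ hn]
    | succ t ht ih =>
      intro hn
      have h1 := ih (by omega)
      have h2 := abs_le.1 (hM t (by omega))
      have h3 : κ (t + 1) - M (t + 1) = κ t - M t + D t := by
        rw [h (t + 1), h t, Finset.sum_range_succ]
        ring
      rw [h3]
      rcases le_or_gt (κ t) δ with hle | hgt
      · linarith [hD t (by linarith) hle]
      · linarith [(abs_le.1 (hD' t)).1]
  linarith [key n ht₀ le_rfl, (abs_le.1 (hM n le_rfl)).1]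

end Trajectories

/-! ### Martingale part of the alignment -/

section Noise

variable {d : ℕ}

/-- The step of the iteration as a function of the current weight and the data point. -/
noncomputable def dataStep (σs : ℝ → ℝ) (σ : ℝ[X]) (γ : ℝ) (θ : E d) (w : E d) (s : E d × ℝ) :
    E d :=
  sgdStep σ γ w s.1 (label σs θ s)

lemma iterate_eq_chain (σs : ℝ → ℝ) (σ : ℝ[X]) (γ : ℝ) (θ w₀ : E d) (ω : ℕ → E d × ℝ) (t : ℕ) :
    iterate σs σ γ θ w₀ ω t = chain (dataStep σs σ γ θ) w₀ ω t := by
  induction t with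
  | zero => rfl
  | succ t ih => rw [iterate, chain, ih, dataStep]

lemma norm_iterate (σs : ℝ → ℝ) (σ : ℝ[X]) (γ : ℝ) (θ : E d) {w₀ : E d} (hw : ‖w₀‖ = 1)
    (ω : ℕ → E d × ℝ) (t : ℕ) : ‖iterate σs σ γ θ w₀ ω t‖ = 1 := by
  induction t with
  | zero => exact hw
  | succ t ih => exact norm_sgdStep σ γ ih _ _

/-- The martingale part of the alignment. -/
noncomputable def noise (σs : ℝ → ℝ) (σ : ℝ[X]) (μ : Measure ℝ) (γ : ℝ) (θ w₀ : E d)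
    (ω : ℕ → E d × ℝ) (t : ℕ) : ℝ :=
  compensated (dataStep σs σ γ θ) (fun w => inner ℝ θ w) (meanIncrement σs σ μ γ θ) w₀ ω t

lemma alignment_eq (σs : ℝ → ℝ) (σ : ℝ[X]) (μ : Measure ℝ) (γ : ℝ) (θ w₀ : E d)
    (ω : ℕ → E d × ℝ) (t : ℕ) :
    alignment σs σ γ θ w₀ ω t = alignment σs σ γ θ w₀ ω 0 +
      ∑ s ∈ Finset.range t, meanIncrement σs σ μ γ θ (iterate σs σ γ θ w₀ ω s) +
        noise σs σ μ γ θ w₀ ω t := by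
  have h := compensated_succ (dataStep σs σ γ θ) (fun w => (inner ℝ θ w : ℝ))
    (meanIncrement σs σ μ γ θ) w₀ ω t
  simp_rw [alignment, iterate_eq_chain]
  exact h

lemma measurable_meanIncrement {σs : ℝ → ℝ} (hm : Measurable σs) (σ : ℝ[X]) (μ : Measure ℝ)
    [IsProbabilityMeasure μ] (γ : ℝ) (θ : E d) : Measurable (meanIncrement σs σ μ γ θ) := by
  have h := (measurable_increment hm σ γ θ).stronglyMeasurable
  exact (h.integral_prod_right (ν := (stdGaussian (E d)).prod μ)).measurable

lemma measure_exists_noise_le {σs : ℝ → ℝ} (hm : Measurable σs) (σ : ℝ[X]) (μ : Measure ℝ)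
    [IsProbabilityMeasure μ] (γ : ℝ) (θ : E d) {V : ℝ}
    (hL2 : ∀ w : E d, ‖w‖ = 1 →
      MemLp (increment σs σ γ θ w) 2 ((stdGaussian (E d)).prod μ))
    (hV : ∀ w : E d, ‖w‖ = 1 →
      ∫ s, increment σs σ γ θ w s ^ 2 ∂((stdGaussian (E d)).prod μ) ≤ V)
    {w₀ : E d} (hw₀ : ‖w₀‖ = 1) {ε : ℝ} (hε : 0 < ε) (n : ℕ) :
    dataLaw d μ {ω | ∃ t ≤ n, ε ≤ |noise σs σ μ γ θ w₀ ω t|} ≤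
      ENNReal.ofReal (n * V / ε ^ 2) := by
  have h := measure_exists_compensated_le ((stdGaussian (E d)).prod μ)
    (step := dataStep σs σ γ θ) (f := fun w => (inner ℝ θ w : ℝ))
    (D := meanIncrement σs σ μ γ θ) (measurable_sgdStep hm σ γ θ) (by fun_prop)
    (measurable_meanIncrement hm σ μ γ θ) (I := {w | ‖w‖ = 1})
    (fun w hw s => norm_sgdStep σ γ hw _ _) hL2 (fun w _ => rfl) hV hε n w₀ hw₀ 0
  simpa [noise, dataLaw] using h

end Noise

/-! ### Probability estimates in a fixed dimension -/

section FiniteDimension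

variable {σs : ℝ → ℝ} {σ : ℝ[X]} {ν : ℕ → Measure ℝ} {p : ℕ} {C c δ : ℝ}

/-- The bounds of `exists_increment_bounds` for given constants. -/
def IncrementBounds (σs : ℝ → ℝ) (σ : ℝ[X]) (ν : ℕ → Measure ℝ) [∀ d, IsProbabilityMeasure (ν d)]
    (p : ℕ) (C c δ : ℝ) : Prop :=
  ∀ d : ℕ, 1 ≤ d → ∀ γ : ℝ, 0 ≤ γ → ∀ θ w : E d, ‖θ‖ = 1 → ‖w‖ = 1 →
    MemLp (increment σs σ γ θ w) 2 ((stdGaussian (E d)).prod (ν d)) ∧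
    ∫ s, increment σs σ γ θ w s ^ 2 ∂((stdGaussian (E d)).prod (ν d)) ≤
      C * (γ ^ 2 + γ ^ 4 * d ^ 2) ∧
    |meanIncrement σs σ (ν d) γ θ w| ≤ C * (γ * |(inner ℝ θ w : ℝ)| ^ (p - 1) +
      |(inner ℝ θ w : ℝ)| * (γ ^ 2 * d) + γ ^ 3 * d) ∧
    (0 ≤ (inner ℝ θ w : ℝ) → (inner ℝ θ w : ℝ) ≤ δ →
      c * γ * (inner ℝ θ w) ^ (p - 1) - C * ((inner ℝ θ w) * (γ ^ 2 * d) + γ ^ 3 * d) ≤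
        meanIncrement σs σ (ν d) γ θ w)

variable [∀ d, IsProbabilityMeasure (ν d)]

/-- With high probability, the alignment stays below `R` for `n` steps. -/
theorem IncrementBounds.necessity (hB : IncrementBounds σs σ ν p C c δ) (hm : Measurable σs)
    (hC : 0 < C) {d : ℕ} (hd : 1 ≤ d) {γ : ℝ} (hγ : 0 ≤ γ) {θ w₀ : E d} (hθ : ‖θ‖ = 1)
    (hw : ‖w₀‖ = 1) {R : ℝ} (hR : 0 < R) (h0 : |(inner ℝ θ w₀ : ℝ)| ≤ R / 2) {n : ℕ}
    (hn : n * (C * (γ * R ^ (p - 1) + R * (γ ^ 2 * d) + γ ^ 3 * d)) ≤ R / 4) :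
    1 ≤ dataLaw d (ν d) {ω | ∀ t ≤ n, |alignment σs σ γ θ w₀ ω t| ≤ R} +
      ENNReal.ofReal (n * (C * (γ ^ 2 + γ ^ 4 * d ^ 2)) / (R / 8) ^ 2) := by
  have : IsProbabilityMeasure (dataLaw d (ν d)) := by
    unfold dataLaw
    infer_instance
  have hP := measure_exists_noise_le hm σ (ν d) γ θ (fun w hw => (hB d hd γ hγ θ w hθ hw).1)
    (fun w hw => (hB d hd γ hγ θ w hθ hw).2.1) hw (ε := R / 8) (by positivity) n
  -- The whole space is covered by the good event and the large-noise event; subadditivity requires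
  -- no measurability of either.
  rw [← measure_univ (μ := dataLaw d (ν d))]
  refine (measure_mono ?_).trans ((measure_union_le _ _).trans (add_le_add_right hP _))
  intro ω _
  by_cases hω : ∃ t ≤ n, R / 8 ≤ |noise σs σ (ν d) γ θ w₀ ω t|
  · exact Or.inr hω
  left
  push Not at hω
  refine abs_le_of_small_drift (alignment_eq σs σ (ν d) γ θ w₀ ω) h0 (fun t ht => (hω t ht).le)
    (β := C * (γ * R ^ (p - 1) + R * (γ ^ 2 * d) + γ ^ 3 * d)) (by positivity) ?_ hn
  intro s hs
  refine ((hB d hd γ hγ θ _ hθ (norm_iterate σs σ γ θ hw ω s)).2.2.1).trans ?_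
  have hs' : |(inner ℝ θ (iterate σs σ γ θ w₀ ω s) : ℝ)| ≤ R := hs
  gcongr

/-- With high probability, the alignment is at least `δ / 2` after `n` steps. -/
theorem IncrementBounds.sufficiency (hB : IncrementBounds σs σ ν p C c δ) (hm : Measurable σs)
    (hC : 0 < C) (hc : 0 < c) (hδ : 0 < δ) {d : ℕ} (hd : 1 ≤ d) {γ : ℝ} (hγ : 0 ≤ γ)
    {θ w₀ : E d} (hθ : ‖θ‖ = 1) (hw : ‖w₀‖ = 1) {r : ℕ} (hr : p - 1 ≤ r + 1) {κ₀ : ℝ}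
    (hκ₀ : inner ℝ θ w₀ = κ₀) (h0 : 0 < κ₀) (h0δ : κ₀ ≤ δ)
    (h1 : C * (γ * d) ≤ c / 4 * (κ₀ / 2) ^ r)
    (h2 : C * (γ ^ 2 * d) ≤ c / 4 * (κ₀ / 2) ^ (r + 1))
    (h3 : C * (γ + γ ^ 2 * d + γ ^ 3 * d) ≤ δ / 8) {N n : ℕ} (hNn : N ≤ n)
    (hN : 1 < κ₀ / 2 * (1 + c / 2 * γ * (κ₀ / 2) ^ r) ^ N) :
    1 ≤ dataLaw d (ν d) {ω | δ / 2 ≤ alignment σs σ γ θ w₀ ω n} +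
      (ENNReal.ofReal (N * (C * (γ ^ 2 + γ ^ 4 * d ^ 2)) / (κ₀ / 2) ^ 2) +
      ENNReal.ofReal (n * (C * (γ ^ 2 + γ ^ 4 * d ^ 2)) / (δ / 8) ^ 2)) := by
  have : IsProbabilityMeasure (dataLaw d (ν d)) := by
    unfold dataLaw
    infer_instance
  -- Two noise levels are needed: `κ₀ / 2` during the `N` steps of escape, and `δ / 8` over all `n`
  -- steps.
  have hP := fun (ε : ℝ) (hε : 0 < ε) (n : ℕ) => measure_exists_noise_le hm σ (ν d) γ θ
    (fun w hw => (hB d hd γ hγ θ w hθ hw).1)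
    (fun w hw => (hB d hd γ hγ θ w hθ hw).2.1) hw (ε := ε) hε n
  rw [← measure_univ (μ := dataLaw d (ν d))]
  refine (measure_mono ?_).trans ((measure_union_le _ _).trans (add_le_add_right
    ((measure_union_le _ _).trans (add_le_add (hP (κ₀ / 2) (by positivity) N)
      (hP (δ / 8) (by positivity) n))) _))
  intro ω _
  by_cases hω1 : ∃ t ≤ N, κ₀ / 2 ≤ |noise σs σ (ν d) γ θ w₀ ω t|
  · exact Or.inr (Or.inl hω1)
  by_cases hω2 : ∃ t ≤ n, δ / 8 ≤ |noise σs σ (ν d) γ θ w₀ ω t|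
  · exact Or.inr (Or.inr hω2)
  left
  push Not at hω1 hω2
  have hal0 : alignment σs σ γ θ w₀ ω 0 = κ₀ := hκ₀
  have hdec := alignment_eq σs σ (ν d) γ θ w₀ ω
  have hle1 : ∀ t, |alignment σs σ γ θ w₀ ω t| ≤ 1 := fun t =>
    abs_inner_le_one hθ (norm_iterate σs σ γ θ hw ω t)
  -- Linearise the drift: `κ^(p-1) ≥ κ^(r+1) ≥ (κ₀/2)^r κ`. By `h1` and `h2` each of the two error
  -- terms absorbs a quarter of `c`, leaving `c / 2`.
  have hdrift : ∀ s, κ₀ / 2 ≤ alignment σs σ γ θ w₀ ω s → alignment σs σ γ θ w₀ ω s ≤ δ →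
      c / 2 * γ * (κ₀ / 2) ^ r * alignment σs σ γ θ w₀ ω s ≤
        meanIncrement σs σ (ν d) γ θ (iterate σs σ γ θ w₀ ω s) := by
    intro s hs1 hs2
    have hs0 : 0 ≤ alignment σs σ γ θ w₀ ω s := by linarith
    refine le_trans ?_ ((hB d hd γ hγ θ _ hθ (norm_iterate σs σ γ θ hw ω s)).2.2.2 hs0 hs2)
    change _ ≤ c * γ * alignment σs σ γ θ w₀ ω s ^ (p - 1) -
      C * (alignment σs σ γ θ w₀ ω s * (γ ^ 2 * d) + γ ^ 3 * d)
    set κ := alignment σs σ γ θ w₀ ω s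
    have hκ1 : κ ≤ 1 := (le_abs_self _).trans (hle1 s)
    have e1 : (κ₀ / 2) ^ r * κ ≤ κ ^ (p - 1) := by
      calc (κ₀ / 2) ^ r * κ ≤ κ ^ r * κ := by gcongr
        _ = κ ^ (r + 1) := (pow_succ κ r).symm
        _ ≤ κ ^ (p - 1) := pow_le_pow_of_le_one hs0 hκ1 hr
    have e2 : c * γ * ((κ₀ / 2) ^ r * κ) ≤ c * γ * κ ^ (p - 1) := by gcongr
    have e3 : C * (γ * d) * (γ * κ) ≤ c / 4 * (κ₀ / 2) ^ r * (γ * κ) := by gcongr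
    have e4 : C * (γ ^ 2 * d) * γ ≤ c / 4 * (κ₀ / 2) ^ (r + 1) * γ := by gcongr
    have e5 : c / 4 * (κ₀ / 2) ^ (r + 1) * γ ≤ c / 4 * ((κ₀ / 2) ^ r * κ) * γ := by
      rw [pow_succ]
      gcongr
    nlinarith
  obtain ⟨t, htN, ht⟩ := exists_gt_of_linear_drift (δ := δ)
    (l := c / 2 * γ * (κ₀ / 2) ^ r) (n := N) hdec (by rw [hal0]; exact h0)
    (fun t ht => by rw [hal0]; exact (hω1 t ht).le) (by positivity)
    (fun s hs1 hs2 => hdrift s (by rwa [hal0] at hs1) hs2)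
    ((le_abs_self _).trans (hle1 N)) (by rw [hal0]; exact hN)
  refine half_le_of_nonneg_drift hdec (fun t ht => (hω2 t ht).le) (htN.trans hNn) ht ?_ ?_
  · intro s hs1 hs2
    refine le_trans ?_ (hdrift s (by linarith) hs2)
    have : 0 ≤ alignment σs σ γ θ w₀ ω s := by linarith
    positivity
  · intro s
    refine ((hB d hd γ hγ θ _ hθ (norm_iterate σs σ γ θ hw ω s)).2.2.1).trans
      (le_trans ?_ h3)
    have hs' : |(inner ℝ θ (iterate σs σ γ θ w₀ ω s) : ℝ)| ≤ 1 := hle1 s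
    have h4 : |(inner ℝ θ (iterate σs σ γ θ w₀ ω s) : ℝ)| ^ (p - 1) ≤ 1 :=
      pow_le_one₀ (abs_nonneg _) hs'
    have h5 := mul_le_of_le_one_right hγ h4
    have h6 : |(inner ℝ θ (iterate σs σ γ θ w₀ ω s) : ℝ)| * (γ ^ 2 * d) ≤ γ ^ 2 * d :=
      mul_le_of_le_one_left (by positivity) hs'
    exact mul_le_mul_of_nonneg_left (by linarith) hC.le

end FiniteDimension

/-! ### Inequalities between powers of `√d` and `log d` -/

section Arithmetic

/-- Dictionary: `x = √d`, `L = log d`, `P = x^(p-2)`, `Q = R^(p-1)`; `Y`, `S`, `A` are the powers of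
`L` from `γ`, from the bound on `P Q`, and from the number of steps. -/
lemma necessity_drift_le {C K x L Y S A R Q P γ n : ℝ} (hC : 0 < C) (hK : 0 ≤ K) (hx : 1 ≤ x)
    (hL : 1 ≤ L) (hY : 1 ≤ Y) (hS : 1 ≤ S) (hA : Y ^ 4 * S * L ≤ A) (hP : 1 ≤ P)
    (hγ0 : 0 ≤ γ) (hγ : γ ≤ Y / (P * x ^ 2)) (hn0 : 0 ≤ n) (hn : n ≤ P ^ 2 * x ^ 2 / A)
    (hRx : 1 ≤ R * x) (hQ0 : 0 ≤ Q) (hQ : P * Q ≤ K * S * R) (hLK : 4 * (C * K + 2 * C) ≤ L) :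
    n * (C * (γ * Q + R * (γ ^ 2 * x ^ 2) + γ ^ 3 * x ^ 2)) ≤ R / 4 := by
  have hx0 : 0 < x := by linarith
  have hL0 : 0 < L := by linarith
  have hP0 : 0 < P := by linarith
  have hR0 : 0 < R := by
    by_contra h
    nlinarith
  have hY0 : 0 < Y := by linarith
  have hA0 : 0 < A := lt_of_lt_of_le (by positivity) hA
  have hYA : ∀ k ≤ 4, Y ^ k * S / A ≤ 1 / L := by
    intro k hk
    rw [div_le_div_iff₀ hA0 hL0, one_mul]
    refine le_trans ?_ hA
    gcongr
  have hYA' : ∀ k ≤ 4, Y ^ k / A ≤ 1 / L := fun k hk =>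
    le_trans (by gcongr; exact le_mul_of_one_le_right (by positivity) hS) (hYA k hk)
  have t1 : n * γ * Q ≤ K * R / L := by
    calc n * γ * Q ≤ P ^ 2 * x ^ 2 / A * (Y / (P * x ^ 2)) * Q := by gcongr
      _ = (P * Q) * (Y / A) := by field_simp
      _ ≤ (K * S * R) * (Y / A) := by gcongr
      _ = K * R * (Y ^ 1 * S / A) := by ring
      _ ≤ K * R * (1 / L) := 
          mul_le_mul_of_nonneg_left (hYA 1 (by norm_num)) (by positivity)
      _ = _ := by ring
  have t2 : n * γ ^ 2 * x ^ 2 ≤ 1 / L := by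
    calc n * γ ^ 2 * x ^ 2 ≤ P ^ 2 * x ^ 2 / A * (Y / (P * x ^ 2)) ^ 2 * x ^ 2 := by gcongr
      _ = Y ^ 2 / A := by field_simp
      _ ≤ _ := hYA' 2 (by norm_num)
  have hγx : γ * x ≤ Y := by
    calc γ * x ≤ Y / (P * x ^ 2) * x := by gcongr
      _ = Y / (P * x) := by field_simp
      _ ≤ Y := div_le_self hY0.le (one_le_mul_of_one_le_of_one_le hP hx)
  have t3 : n * γ ^ 3 * x ^ 2 ≤ R / L := by
    calc n * γ ^ 3 * x ^ 2 ≤ n * γ ^ 3 * x ^ 2 * (R * x) :=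
          le_mul_of_one_le_right (by positivity) hRx
      _ = (n * γ ^ 2 * x ^ 2) * (γ * x) * R := by ring
      _ ≤ (P ^ 2 * x ^ 2 / A * (Y / (P * x ^ 2)) ^ 2 * x ^ 2) * Y * R := by gcongr
      _ = R * (Y ^ 3 / A) := by field_simp
      _ ≤ R * (1 / L) := 
          mul_le_mul_of_nonneg_left (hYA' 3 (by norm_num)) (by positivity)
      _ = _ := by ring
  calc n * (C * (γ * Q + R * (γ ^ 2 * x ^ 2) + γ ^ 3 * x ^ 2))
      = C * (n * γ * Q + R * (n * γ ^ 2 * x ^ 2) + n * γ ^ 3 * x ^ 2) := by ring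
    _ ≤ C * (K * R / L + R * (1 / L) + R / L) := by gcongr
    _ = (C * K + 2 * C) * R / L := by ring
    _ ≤ R / 4 := by
        rw [div_le_div_iff₀ hL0 (by norm_num)]
        nlinarith

/-- The factor `Y⁴` is `Y²` from `γ²` times `Y²` from `1 + (γ d)²`; dividing by it and by one more
`L` makes the failure probability vanish. -/
lemma necessity_noise_le {C x L Y A R P γ n : ℝ} (hC : 0 < C) (hx : 1 ≤ x)
    (hL : 1 ≤ L) (hY : 1 ≤ Y) (hA : Y ^ 4 * L ≤ A) (hP : 1 ≤ P)
    (hγ0 : 0 ≤ γ) (hγ : γ ≤ Y / (P * x ^ 2)) (hn : n ≤ P ^ 2 * x ^ 2 / A)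
    (hR : 0 < R) (hRx : 1 ≤ R * x) :
    n * (C * (γ ^ 2 + γ ^ 4 * (x ^ 2) ^ 2)) / (R / 8) ^ 2 ≤ 128 * C / L := by
  have hx0 : 0 < x := by linarith
  have hL0 : 0 < L := by linarith
  have hP0 : 0 < P := by linarith
  have hY0 : 0 < Y := by linarith
  have hA0 : 0 < A := lt_of_lt_of_le (by positivity) hA
  have hγx : γ * x ^ 2 ≤ Y := by
    calc γ * x ^ 2 ≤ Y / (P * x ^ 2) * x ^ 2 := by gcongr
      _ = Y / P := by field_simp
      _ ≤ Y := div_le_self hY0.le hP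
  have h1 : 1 + (γ * x ^ 2) ^ 2 ≤ 2 * Y ^ 2 := by
    have : (γ * x ^ 2) ^ 2 ≤ Y ^ 2 := by gcongr
    have : 1 ≤ Y ^ 2 := one_le_pow₀ hY
    linarith
  have h2 : 1 / R ^ 2 ≤ x ^ 2 := by
    rw [div_le_iff₀ (by positivity)]
    calc (1 : ℝ) ≤ (R * x) ^ 2 := one_le_pow₀ hRx
      _ = _ := by ring
  calc n * (C * (γ ^ 2 + γ ^ 4 * (x ^ 2) ^ 2)) / (R / 8) ^ 2
      = 64 * C * (n * γ ^ 2 * (1 + (γ * x ^ 2) ^ 2)) * (1 / R ^ 2) := by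
        field_simp
        ring
    _ ≤ 64 * C * (P ^ 2 * x ^ 2 / A * (Y / (P * x ^ 2)) ^ 2 * (2 * Y ^ 2)) * x ^ 2 := by
        gcongr
    _ = 128 * C * (Y ^ 4 / A) := by
        field_simp
        ring
    _ ≤ 128 * C * (1 / L) := by
        refine mul_le_mul_of_nonneg_left ?_ (by positivity)
        rw [div_le_div_iff₀ hA0 hL0, one_mul]
        exact hA
    _ = _ := by ring

/-- For `l ≤ 1` one has `1 + l ≥ exp (l/2)`, so `N ≥ 4 L / l` steps of growth gain a factor `exp (2
L) = x⁴`. -/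
lemma one_lt_mul_one_add_pow {κ l x L : ℝ} {N : ℕ} (hl : 0 < l) (hl1 : l ≤ 1) (hx : 0 < x)
    (hL : Real.exp (2 * L) = x ^ 4) (hN : 4 * L / l ≤ N) (hκ : 2 < κ * x ^ 4) :
    1 < κ / 2 * (1 + l) ^ N := by
  have h1 : Real.exp (l / 2) ≤ 1 + l := by
    have h2 := Real.add_one_le_exp (-(l / 2))
    rw [Real.exp_neg] at h2
    have h3 : 0 < Real.exp (l / 2) := Real.exp_pos _
    have h4 : (-(l / 2) + 1) * Real.exp (l / 2) ≤ 1 := by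
      calc (-(l / 2) + 1) * Real.exp (l / 2) ≤ (Real.exp (l / 2))⁻¹ * Real.exp (l / 2) := by
            gcongr
        _ = 1 := inv_mul_cancel₀ h3.ne'
    have h5 : 0 < -(l / 2) + 1 := by linarith
    have h6 : 1 ≤ (-(l / 2) + 1) * (1 + l) := by nlinarith
    exact le_of_mul_le_mul_left (h4.trans h6) h5
  have h2 : x ^ 4 ≤ (1 + l) ^ N := by
    rw [← hL]
    calc Real.exp (2 * L) ≤ Real.exp (N * (l / 2)) := by
          refine Real.exp_le_exp.2 ?_
          rw [div_le_iff₀ hl] at hN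
          linarith
      _ = Real.exp (l / 2) ^ N := by rw [← Real.exp_nat_mul]
      _ ≤ _ := by gcongr
  have hκ0 : 0 < κ := by
    by_contra h
    have : 0 < x ^ 4 := by positivity
    nlinarith
  nlinarith

/-- The factor `L²` in `W` pays once for the logarithm in the number of steps and once for the decay
`1 / L`. -/
lemma mul_div_div_le {C c L γ u z t q W : ℝ} (hC : 0 ≤ C) (hc : 0 < c) (hL : 0 < L)
    (hu : 0 < u) (hz : 0 < z) (ht : 0 < t) (hγ : γ ≤ 1 / (u * W)) (hW : W = z * L ^ 2)
    (hq : 1 / (t * u * z) ≤ q) : 20 * C * L * γ / c / q ≤ (20 * C / c * t) / L := by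
  subst hW
  have hq0 : 0 < q := lt_of_lt_of_le (by positivity) hq
  have h1 : γ ≤ t / L ^ 2 * q := by
    calc γ ≤ 1 / (u * (z * L ^ 2)) := hγ
      _ = t / L ^ 2 * (1 / (t * u * z)) := by field_simp
      _ ≤ t / L ^ 2 * q := by gcongr
  rw [div_le_iff₀ hq0]
  calc 20 * C * L * γ / c ≤ 20 * C * L * (t / L ^ 2 * q) / c := by gcongr
    _ = (20 * C / c * t) / L * q := by field_simp

set_option maxHeartbeats 800000 in
lemma sufficiency_arithmetic {C c δ x L Y Z W A A' γ κ : ℝ} {r n : ℕ} (hC : 0 < C) (hc : 0 < c)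
    (hδ : 0 < δ) (hx : 1 ≤ x) (hL : 1 ≤ L) (hLx : Real.exp (2 * L) = x ^ 4) (hY : 1 ≤ Y)
    (hZ : 1 ≤ Z) (hW : W = Z ^ (r + 2) * L ^ 2) (hA : A = Y * Z ^ r * L ^ 2)
    (hγ : γ ≤ 1 / (x ^ (r + 2) * W)) (hγ' : 1 / (x ^ (r + 2) * Y) ≤ γ) (hκ : 1 / (x * Z) ≤ κ)
    (hn : A * x ^ (2 * r + 2) ≤ n) (hn' : n ≤ A' * x ^ (2 * r + 2)) (hκ2 : κ ≤ 2)
    (l1 : 4 * C * 2 ^ r ≤ c * L) (l2 : 4 * C * 2 ^ (r + 1) * Z ^ (r + 1) ≤ c * x)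
    (l3 : 24 * C ≤ δ * x) (l4 : c ≤ x) (l5 : 2 * Z < x) (l6 : 10 * 2 ^ r ≤ c * L)
    (l7 : A' * L ≤ x) :
    C * (γ * x ^ 2) ≤ c / 4 * (κ / 2) ^ r ∧
    C * (γ ^ 2 * x ^ 2) ≤ c / 4 * (κ / 2) ^ (r + 1) ∧
    C * (γ + γ ^ 2 * x ^ 2 + γ ^ 3 * x ^ 2) ≤ δ / 8 ∧
    n * (C * (γ ^ 2 + γ ^ 4 * (x ^ 2) ^ 2)) / (δ / 8) ^ 2 ≤ (128 * C / δ ^ 2) / L ∧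
    ∃ N : ℕ, N ≤ n ∧ 1 < κ / 2 * (1 + c / 2 * γ * (κ / 2) ^ r) ^ N ∧
      N * (C * (γ ^ 2 + γ ^ 4 * (x ^ 2) ^ 2)) / (κ / 2) ^ 2 ≤
        (20 * C / c * 2 ^ (r + 2)) / L := by
  have hx0 : 0 < x := by linarith
  have hL0 : 0 < L := by linarith
  have hZ0 : 0 < Z := by linarith
  have hY0 : 0 < Y := by linarith
  have hW1 : 1 ≤ W := by
    rw [hW]
    exact one_le_mul_of_one_le_of_one_le (one_le_pow₀ hZ) (one_le_pow₀ hL)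
  have hW0 : 0 < W := by linarith
  have hγ0 : 0 < γ := lt_of_lt_of_le (by positivity) hγ'
  have hκ0 : 0 < κ := lt_of_lt_of_le (by positivity) hκ
  have hP1 : 1 ≤ x ^ r := one_le_pow₀ hx
  have hP0 : 0 < x ^ r := by linarith
  have hLL : L ≤ L ^ 2 := by nlinarith
  have hq : ∀ k : ℕ, 1 / (2 ^ k * x ^ k * Z ^ k) ≤ (κ / 2) ^ k := by
    intro k
    have : 1 / (2 ^ k * x ^ k * Z ^ k) = (1 / (x * Z) / 2) ^ k := by
      rw [div_pow, div_pow, mul_pow, one_pow]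
      field_simp
    rw [this]
    gcongr
  have hq1 : (κ / 2) ^ r ≤ 1 := pow_le_one₀ (by positivity) (by linarith)
  have hγx : γ * x ^ 2 ≤ 1 / (x ^ r * W) := by
    calc γ * x ^ 2 ≤ 1 / (x ^ (r + 2) * W) * x ^ 2 := by gcongr
      _ = _ := by
        rw [pow_add]
        field_simp
  have hγ1 : γ * x ^ 2 ≤ 1 := by
    refine hγx.trans ?_
    rw [div_le_one (by positivity)]
    exact one_le_mul_of_one_le_of_one_le hP1 hW1
  have hx2 : 1 ≤ x ^ 2 := one_le_pow₀ hx
  have hxx : x ≤ x ^ 2 := by nlinarith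
  have hγle : γ ≤ 1 / x ^ 2 := by
    rw [le_div_iff₀ (by positivity)]
    exact hγ1
  have hγone : γ ≤ 1 := hγle.trans (by rw [div_le_one (by positivity)]; exact hx2)
  have hvar : C * (γ ^ 2 + γ ^ 4 * (x ^ 2) ^ 2) ≤ 2 * C * γ ^ 2 := by
    have h1 : (γ * x ^ 2) ^ 2 ≤ 1 := pow_le_one₀ (by positivity) hγ1
    have h2 : γ ^ 2 + γ ^ 4 * (x ^ 2) ^ 2 = γ ^ 2 * (1 + (γ * x ^ 2) ^ 2) := by ring
    rw [h2]
    calc C * (γ ^ 2 * (1 + (γ * x ^ 2) ^ 2)) ≤ C * (γ ^ 2 * (1 + 1)) := by gcongr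
      _ = _ := by ring
  refine ⟨?_, ?_, ?_, ?_, ?_⟩
  · calc C * (γ * x ^ 2) ≤ C * (1 / (x ^ r * W)) := by gcongr
      _ ≤ c / 4 * (1 / (2 ^ r * x ^ r * Z ^ r)) := by
          rw [mul_one_div, mul_one_div, div_div, div_le_div_iff₀ (by positivity) (by positivity)]
          have h1 : 4 * C * 2 ^ r * Z ^ r ≤ c * W := by
            rw [hW]
            calc 4 * C * 2 ^ r * Z ^ r ≤ c * L * Z ^ r := by gcongr
              _ ≤ c * L ^ 2 * Z ^ (r + 2) := by
                  gcongr
                  omega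
              _ = _ := by ring
          calc C * (4 * (2 ^ r * x ^ r * Z ^ r)) = x ^ r * (4 * C * 2 ^ r * Z ^ r) := by ring
            _ ≤ x ^ r * (c * W) := by gcongr
            _ = _ := by ring
      _ ≤ _ := by
          gcongr
          exact hq r
  · calc C * (γ ^ 2 * x ^ 2) = C * γ * (γ * x ^ 2) := by ring
      _ ≤ C * (1 / x ^ 2) * (1 / (x ^ r * W)) := by gcongr
      _ ≤ C * (1 / x ^ 2) * (1 / (x ^ r * 1)) := by gcongr
      _ = C / (x ^ r * x ^ 2) := by field_simp
      _ ≤ c / 4 * (1 / (2 ^ (r + 1) * x ^ (r + 1) * Z ^ (r + 1))) := by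
          rw [mul_one_div, div_div, div_le_div_iff₀ (by positivity) (by positivity)]
          calc C * (4 * (2 ^ (r + 1) * x ^ (r + 1) * Z ^ (r + 1)))
              = x ^ (r + 1) * (4 * C * 2 ^ (r + 1) * Z ^ (r + 1)) := by ring
            _ ≤ x ^ (r + 1) * (c * x) := by gcongr
            _ = _ := by ring
      _ ≤ _ := by
          gcongr
          exact hq (r + 1)
  · have h1 : γ ^ 2 * x ^ 2 ≤ γ := by
      calc γ ^ 2 * x ^ 2 = γ * (γ * x ^ 2) := by ring
        _ ≤ γ := mul_le_of_le_one_right hγ0.le hγ1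
    have h2 : γ ^ 3 * x ^ 2 ≤ γ := by
      calc γ ^ 3 * x ^ 2 = (γ ^ 2 * x ^ 2) * γ := by ring
        _ ≤ γ * 1 := by gcongr
        _ = γ := mul_one γ
    calc C * (γ + γ ^ 2 * x ^ 2 + γ ^ 3 * x ^ 2) ≤ C * (3 * (1 / x ^ 2)) := by
          gcongr
          linarith
      _ ≤ δ / 8 := by
          rw [mul_one_div, ← mul_div_assoc, div_le_div_iff₀ (by positivity) (by norm_num)]
          nlinarith
  · have hA'0 : 0 ≤ A' := by
      have h1 : 0 ≤ A' * x ^ (2 * r + 2) := (Nat.cast_nonneg n).trans hn'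
      exact nonneg_of_mul_nonneg_left h1 (by positivity)
    calc n * (C * (γ ^ 2 + γ ^ 4 * (x ^ 2) ^ 2)) / (δ / 8) ^ 2
        ≤ (A' * x ^ (2 * r + 2)) * (2 * C * (1 / (x ^ (r + 2) * W)) ^ 2) / (δ / 8) ^ 2 := by
          have h1 : 2 * C * γ ^ 2 ≤ 2 * C * (1 / (x ^ (r + 2) * W)) ^ 2 := by gcongr
          have h2 := hvar.trans h1
          gcongr
      _ ≤ (A' * x ^ (2 * r + 2)) * (2 * C * (1 / (x ^ (r + 2) * 1)) ^ 2) / (δ / 8) ^ 2 := by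
          gcongr
      _ = 128 * C / δ ^ 2 * (A' / x ^ 2) := by
          have : x ^ (2 * r + 2) = (x ^ r) ^ 2 * x ^ 2 := by ring
          rw [this, pow_add x r 2]
          field_simp
          ring
      _ ≤ 128 * C / δ ^ 2 * (1 / L) := by
          refine mul_le_mul_of_nonneg_left ?_ (by positivity)
          rw [div_le_div_iff₀ (by positivity) hL0]
          linarith
      _ = _ := by ring
  · set l := c / 2 * γ * (κ / 2) ^ r with hl
    have hl0 : 0 < l := by positivity
    have hl1 : l ≤ 1 := by
      calc l ≤ c / 2 * (1 / x ^ 2) * 1 := by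
            rw [hl]
            gcongr
        _ ≤ 1 := by
            rw [mul_one, mul_one_div, div_le_one (by positivity)]
            linarith
    -- Rounding up costs at most `1 ≤ L / l`.
    have hNle : ((⌈4 * L / l⌉₊ : ℕ) : ℝ) ≤ 5 * L / l := by
      have h1 : ((⌈4 * L / l⌉₊ : ℕ) : ℝ) ≤ 4 * L / l + 1 :=
        (Nat.ceil_lt_add_one (by positivity)).le
      have h2 : 1 ≤ L / l := by
        rw [one_le_div hl0]
        linarith
      calc _ ≤ 4 * L / l + 1 := h1
        _ ≤ 4 * L / l + L / l := by linarith
        _ = _ := by ring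
    refine ⟨⌈4 * L / l⌉₊, ?_, ?_, ?_⟩
    · have h1 : 5 * L / l ≤ n := by
        refine le_trans ?_ hn
        have h2 : c / 2 * (1 / (x ^ (r + 2) * Y)) * (1 / (2 ^ r * x ^ r * Z ^ r)) ≤ l := by
          rw [hl]
          gcongr
          exact hq r
        calc 5 * L / l ≤ 5 * L /
              (c / 2 * (1 / (x ^ (r + 2) * Y)) * (1 / (2 ^ r * x ^ r * Z ^ r))) := by gcongr
          _ = 10 * 2 ^ r * (L * Y * Z ^ r * x ^ (2 * r + 2)) / c := by
              have : x ^ (2 * r + 2) = x ^ (r + 2) * x ^ r := by ring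
              rw [this]
              field_simp
              norm_num
          _ ≤ c * L * (L * Y * Z ^ r * x ^ (2 * r + 2)) / c := by gcongr
          _ = _ := by
              rw [hA]
              field_simp
      exact_mod_cast hNle.trans h1
    · refine one_lt_mul_one_add_pow hl0 hl1 hx0 hLx (Nat.le_ceil _) ?_
      calc 2 < x / Z := by rwa [lt_div_iff₀ hZ0]
        _ = 1 / (x * Z) * x ^ 2 := by field_simp
        _ ≤ κ * x ^ 4 := by
            gcongr
            norm_num
    · have h1 : (κ / 2) ^ (r + 2) = (κ / 2) ^ r * (κ / 2) ^ 2 := pow_add _ _ _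
      -- Since `l` is proportional to `γ (κ/2)^r`, the noise-to-signal ratio during escape is of
      -- order `L γ / κ^(r+2)`. At the scale of `γ` only logarithms remain, whence the additional
      -- smallness assumed of `γ`.
      calc ((⌈4 * L / l⌉₊ : ℕ) : ℝ) * (C * (γ ^ 2 + γ ^ 4 * (x ^ 2) ^ 2)) / (κ / 2) ^ 2
          ≤ 5 * L / l * (2 * C * γ ^ 2) / (κ / 2) ^ 2 := by gcongr
        _ = 20 * C * L * γ / c / (κ / 2) ^ (r + 2) := by
            rw [h1, hl]
            field_simp
            ring
        _ ≤ _ := mul_div_div_le (by positivity) hc hL0 (by positivity) (by positivity)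
            (by positivity) hγ hW (hq (r + 2))

end Arithmetic

/-! ### Passage to the limit in the dimension -/

section Asymptotics

/-- Truncated subtraction gives `p - 2 + 2 = max p 2`, so one formula covers `p = 1` as well;
`iterScale_eq` uses the same device. -/
lemma stepScale_eq {p d : ℕ} (hp : 1 ≤ p) (hd : 1 ≤ d) :
    stepScale p d = 1 / Real.sqrt d ^ (p - 2 + 2) := by
  have hd0 : (0 : ℝ) ≤ d := by positivity
  have h1 : max ((p : ℝ) / 2) 1 = (1 / 2) * ((p - 2 + 2 : ℕ) : ℝ) := by
    rcases le_or_gt 2 p with h | h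
    · have h2 : (2 : ℝ) ≤ p := by exact_mod_cast h
      rw [Nat.sub_add_cancel h, max_eq_left (by linarith)]
      ring
    · have : p = 1 := by omega
      subst this
      norm_num
  rw [stepScale, h1, Real.rpow_neg hd0, Real.sqrt_eq_rpow, Real.rpow_mul hd0, Real.rpow_natCast,
    ← one_div]

lemma iterScale_eq (p d : ℕ) (hp : 1 ≤ p) :
    iterScale p d = Real.sqrt d ^ (2 * (p - 2) + 2) := by
  have h1 : 2 * (p - 2) + 2 = 2 * max (p - 1) 1 := by omega
  rw [iterScale, h1, pow_mul, Real.sq_sqrt (by positivity)]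

lemma rpow_neg_half_eq (d : ℕ) : (d : ℝ) ^ (-(1 / 2) : ℝ) = 1 / Real.sqrt d := by
  rw [Real.rpow_neg (by positivity), Real.sqrt_eq_rpow, one_div ((d : ℝ) ^ (1 / 2 : ℝ))]

lemma tendsto_sqrt_natCast : Tendsto (fun d : ℕ => Real.sqrt d) atTop atTop :=
  Real.tendsto_sqrt_atTop.comp tendsto_natCast_atTop_atTop

lemma tendsto_log_natCast : Tendsto (fun d : ℕ => Real.log d) atTop atTop :=
  Real.tendsto_log_atTop.comp tendsto_natCast_atTop_atTop

lemma eventually_mul_log_pow_le_sqrt (K : ℝ) (j : ℕ) :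
    ∀ᶠ d : ℕ in atTop, K * Real.log d ^ j ≤ Real.sqrt d := by
  have h := (Real.isLittleO_pow_log_id_atTop (n := j)).comp_tendsto tendsto_sqrt_natCast
  have h2 := h.bound (c := (1 + |K| * 2 ^ j)⁻¹) (by positivity)
  filter_upwards [h2, eventually_ge_atTop 1] with d hd h1
  have hd1 : (1 : ℝ) ≤ d := by exact_mod_cast h1
  have hlog : Real.log d = 2 * Real.log (Real.sqrt d) := by
    rw [Real.log_sqrt (by positivity)]
    ring
  have hs : 0 ≤ Real.log (Real.sqrt d) := Real.log_nonneg (Real.one_le_sqrt.2 hd1)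
  simp only [Function.comp_apply, id_eq, Real.norm_eq_abs] at hd
  rw [abs_of_nonneg (pow_nonneg hs j), abs_of_nonneg (Real.sqrt_nonneg _),
    le_inv_mul_iff₀ (by positivity)] at hd
  rw [hlog, mul_pow]
  have h3 : 0 ≤ Real.log (Real.sqrt d) ^ j := pow_nonneg hs j
  have h4 : K * (2 ^ j * Real.log (Real.sqrt d) ^ j) ≤
      |K| * (2 ^ j * Real.log (Real.sqrt d) ^ j) :=
    mul_le_mul_of_nonneg_right (le_abs_self K) (by positivity)
  nlinarith

lemma exp_two_mul_log {d : ℕ} (hd : 1 ≤ d) : Real.exp (2 * Real.log d) = Real.sqrt d ^ 4 := by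
  have hd0 : (0 : ℝ) < d := by exact_mod_cast hd
  have h1 : Real.sqrt d ^ 4 = (Real.sqrt d ^ 2) ^ 2 := by ring
  rw [h1, Real.sq_sqrt hd0.le, two_mul, Real.exp_add, Real.exp_log hd0]
  ring

/-- Probabilities that are at least `1 - o(1)` tend to `1`. -/
lemma tendsto_measure_one {Ω : ℕ → Type*} [∀ d, MeasurableSpace (Ω d)] (P : ∀ d, Measure (Ω d))
    [∀ d, IsProbabilityMeasure (P d)] (S : ∀ d, Set (Ω d)) (K : ℝ)
    (h : ∀ᶠ d : ℕ in atTop, 1 ≤ P d (S d) + ENNReal.ofReal (K / Real.log d)) :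
    Tendsto (fun d => P d (S d)) atTop (𝓝 1) := by
  have h1 : Tendsto (fun d : ℕ => ENNReal.ofReal (K / Real.log d)) atTop (𝓝 0) := by
    rw [← ENNReal.ofReal_zero]
    exact ENNReal.tendsto_ofReal (tendsto_log_natCast.const_div_atTop K)
  have h2 : Tendsto (fun d : ℕ => 1 - ENNReal.ofReal (K / Real.log d)) atTop (𝓝 1) := by
    have := ENNReal.Tendsto.sub (tendsto_const_nhds (x := (1 : ENNReal))) h1
      (Or.inl ENNReal.one_ne_top)
    rwa [tsub_zero] at this
  refine tendsto_of_tendsto_of_tendsto_of_le_of_le' h2 tendsto_const_nhds ?_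
    (Eventually.of_forall fun d => prob_le_one)
  filter_upwards [h] with d hd
  exact tsub_le_iff_right.2 hd

instance isProbabilityMeasure_dataLaw (d : ℕ) (μ : Measure ℝ) [IsProbabilityMeasure μ] :
    IsProbabilityMeasure (dataLaw d μ) := by
  unfold dataLaw
  infer_instance

variable {σs : ℝ → ℝ} {σ : ℝ[X]} {ν : ℕ → Measure ℝ} [∀ d, IsProbabilityMeasure (ν d)] {p : ℕ}
  {C c δ : ℝ}

/-- Fewer than `d^{(p-1) ∨ 1}` iterations, up to logarithms, do not leave `[-R, R]`. -/
lemma IncrementBounds.tendsto_necessity (hB : IncrementBounds σs σ ν p C c δ)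
    (hm : Measurable σs) (hC : 0 < C) (hp : 1 ≤ p) {b b' s : ℕ} {θ w₀ : ∀ d : ℕ, E d}
    {γ : ℕ → ℝ} (hinit : GoodInit b θ w₀) (hγ : PolylogComparable b' γ (stepScale p))
    {R : ℕ → ℝ} {K : ℝ} (hK : 0 ≤ K)
    (hR : ∀ᶠ d : ℕ in atTop, 0 < R d ∧ 1 ≤ R d * Real.sqrt d ∧
      Real.log d ^ b / Real.sqrt d ≤ R d / 2 ∧
      Real.sqrt d ^ (p - 2) * R d ^ (p - 1) ≤ K * Real.log d ^ s * R d) :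
    Tendsto (fun d : ℕ => dataLaw d (ν d)
      {ω | ∀ t : ℕ, (t : ℝ) ≤ iterScale p d / Real.log d ^ (4 * b' + s + 1) →
        |alignment σs σ (γ d) (θ d) (w₀ d) ω t| ≤ R d}) atTop (𝓝 1) := by
  refine tendsto_measure_one _ _ (128 * C) ?_
  filter_upwards [hR, hγ, hinit.2, eventually_ge_atTop 1,
    tendsto_log_natCast.eventually_ge_atTop 1,
    tendsto_log_natCast.eventually_ge_atTop (4 * (C * K + 2 * C))]
    with d ⟨hR0, hRx, hR2, hRp⟩ ⟨hγl, hγu⟩ ⟨hκl, hκu⟩ hd hL hLK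
  have hd1 : (1 : ℝ) ≤ d := by exact_mod_cast hd
  have hx1 : 1 ≤ Real.sqrt d := Real.one_le_sqrt.2 hd1
  have hdx : (d : ℝ) = Real.sqrt d ^ 2 := (Real.sq_sqrt (by positivity)).symm
  rw [stepScale_eq hp hd] at hγl hγu
  rw [rpow_neg_half_eq] at hκl hκu
  rw [iterScale_eq p d hp]
  set x := Real.sqrt d with hx
  set L := Real.log d with hLdef
  have hx0 : 0 < x := by linarith
  have hL0 : 0 < L := by linarith
  obtain ⟨hθ, hw⟩ := hinit.1 d hd
  have hγ0 : 0 ≤ γ d := le_trans (by positivity) hγl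
  have hκ0 : (0 : ℝ) ≤ inner ℝ (θ d) (w₀ d) := le_trans (by positivity) hκl
  set n := ⌊x ^ (2 * (p - 2) + 2) / L ^ (4 * b' + s + 1)⌋₊ with hn
  have hnle : (n : ℝ) ≤ (x ^ (p - 2)) ^ 2 * x ^ 2 / L ^ (4 * b' + s + 1) := by
    refine (Nat.floor_le (by positivity)).trans (le_of_eq ?_)
    congr 1
    ring
  have hγu' : γ d ≤ L ^ b' / (x ^ (p - 2) * x ^ 2) := by
    rw [← pow_add, ← mul_one_div]
    exact hγu
  have hA : (L ^ b') ^ 4 * L ^ s * L ≤ L ^ (4 * b' + s + 1) := le_of_eq (by ring)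
  have hA' : (L ^ b') ^ 4 * L ≤ L ^ (4 * b' + s + 1) := by
    refine le_trans ?_ hA
    have h1 : 1 ≤ L ^ s := one_le_pow₀ hL
    have h2 : (L ^ b') ^ 4 ≤ (L ^ b') ^ 4 * L ^ s := le_mul_of_one_le_right (by positivity) h1
    gcongr
  have hP1 : 1 ≤ x ^ (p - 2) := one_le_pow₀ hx1
  have hκR : |(inner ℝ (θ d) (w₀ d) : ℝ)| ≤ R d / 2 := by
    rw [abs_of_nonneg hκ0]
    refine hκu.trans ?_
    rw [mul_one_div]
    exact hR2
  have hdrift := necessity_drift_le (n := n) hC hK hx1 hL (one_le_pow₀ (n := b') hL)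
    (one_le_pow₀ (n := s) hL) hA hP1 hγ0 hγu' (by positivity) hnle hRx
    (pow_nonneg hR0.le (p - 1)) hRp hLK
  have hnoise := necessity_noise_le (n := n) hC hx1 hL (one_le_pow₀ (n := b') hL) hA' hP1 hγ0
    hγu' hnle hR0 hRx
  rw [← hdx] at hdrift hnoise
  refine (hB.necessity hm hC hd hγ0 hθ hw hR0 hκR hdrift).trans ?_
  gcongr with ω t
  exact fun h => Nat.le_floor h

/-- The necessity of `d^{(p-1) ∨ 1}` iterations, up to logarithms. -/
theorem IncrementBounds.weak_recovery_necessity (hB : IncrementBounds σs σ ν p C c δ)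
    (hm : Measurable σs) (hC : 0 < C) (hp : 1 ≤ p) (b b' e : ℕ) :
    ∃ a : ℕ, ∀ (θ w₀ : ∀ d : ℕ, E d) (γ : ℕ → ℝ), GoodInit b θ w₀ →
      PolylogComparable b' γ (stepScale p) →
      Tendsto (fun d : ℕ => dataLaw d (ν d)
          {ω | ∀ t : ℕ, (t : ℝ) ≤ iterScale p d / Real.log d ^ a →
            alignment σs σ (γ d) (θ d) (w₀ d) ω t < 1 / Real.log d ^ e})
        atTop (𝓝 1) := by
  obtain ⟨R, K, s, hK, hR, hRe⟩ : ∃ (R : ℕ → ℝ) (K : ℝ) (s : ℕ), 0 ≤ K ∧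
      (∀ᶠ d : ℕ in atTop, 0 < R d ∧ 1 ≤ R d * Real.sqrt d ∧
        Real.log d ^ b / Real.sqrt d ≤ R d / 2 ∧
        Real.sqrt d ^ (p - 2) * R d ^ (p - 1) ≤ K * Real.log d ^ s * R d) ∧
      ∀ᶠ d : ℕ in atTop, R d < 1 / Real.log d ^ e := by
    -- For `p = 1` the drift does not shrink with `κ`, so `R` is taken just below the target level.
    -- For `p ≥ 2`, `R` is a multiple of the upper bound on the initial alignment, and `x^r R^(r+1)
    -- = (4 L^b)^r R` supplies `K` and `s`.
    rcases hp.eq_or_lt with rfl | hp2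
    · refine ⟨fun d => 1 / (2 * Real.log d ^ e), 2, e, by norm_num, ?_, ?_⟩
      · filter_upwards [tendsto_log_natCast.eventually_ge_atTop 1,
          tendsto_sqrt_natCast.eventually_ge_atTop 1,
          eventually_mul_log_pow_le_sqrt 2 e, eventually_mul_log_pow_le_sqrt 4 (b + e)]
          with d hL hx h1 h2
        have hL0 : 0 < Real.log d := by linarith
        have hx0 : 0 < Real.sqrt d := by linarith
        refine ⟨by positivity, ?_, ?_, ?_⟩
        · rw [one_div_mul_eq_div, one_le_div (by positivity)]
          exact h1
        · rw [div_div, div_le_div_iff₀ hx0 (by positivity)]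
          rw [pow_add] at h2
          linarith
        · simp only [pow_zero, le_refl, Nat.sub_eq_zero_of_le, Nat.one_le_ofNat]
          field_simp
          exact le_rfl
      · filter_upwards [tendsto_log_natCast.eventually_ge_atTop 1] with d hL
        have hL0 : 0 < Real.log d := by linarith
        have : 0 < Real.log d ^ e := by positivity
        exact one_div_lt_one_div_of_lt this (by linarith)
    · obtain ⟨r, rfl⟩ : ∃ r, p = r + 2 := ⟨p - 2, by omega⟩
      refine ⟨fun d => 4 * Real.log d ^ b / Real.sqrt d, 4 ^ r, b * r, by positivity, ?_, ?_⟩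
      · filter_upwards [tendsto_log_natCast.eventually_ge_atTop 1,
          tendsto_sqrt_natCast.eventually_ge_atTop 1] with d hL hx
        have hL0 : 0 < Real.log d := by linarith
        have hx0 : 0 < Real.sqrt d := by linarith
        have hLb : 1 ≤ Real.log d ^ b := one_le_pow₀ hL
        refine ⟨by positivity, ?_, ?_, ?_⟩
        · rw [div_mul_cancel₀ _ hx0.ne']
          linarith
        · rw [div_div, div_le_div_iff₀ hx0 (by positivity)]
          nlinarith [mul_pos hx0 (by linarith : 0 < Real.log d ^ b)]
        · refine le_of_eq ?_
          rw [Nat.add_sub_cancel, show r + 2 - 1 = r + 1 by omega, pow_succ, ← mul_assoc,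
            ← mul_pow, mul_div_cancel₀ _ hx0.ne', mul_pow, ← pow_mul]
      · filter_upwards [tendsto_log_natCast.eventually_ge_atTop 1,
          tendsto_sqrt_natCast.eventually_ge_atTop 1,
          eventually_mul_log_pow_le_sqrt 5 (b + e)] with d hL hx h1
        have hL0 : 0 < Real.log d := by linarith
        have hx0 : 0 < Real.sqrt d := by linarith
        rw [div_lt_div_iff₀ hx0 (by positivity)]
        rw [pow_add] at h1
        have : 0 < Real.log d ^ b * Real.log d ^ e := by positivity
        linarith
  refine ⟨4 * b' + s + 1, fun θ w₀ γ hinit hγ => ?_⟩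
  have h := hB.tendsto_necessity hm hC hp hinit hγ hK hR
  refine tendsto_of_tendsto_of_tendsto_of_le_of_le' h tendsto_const_nhds ?_
    (Eventually.of_forall fun d => prob_le_one)
  filter_upwards [hRe] with d hd
  refine measure_mono fun ω hω t ht => ?_
  exact ((le_abs_self _).trans (hω t ht)).trans_lt hd

/-- The sufficiency of `d^{(p-1) ∨ 1}` iterations, up to logarithms. -/
theorem IncrementBounds.weak_recovery_sufficiency (hB : IncrementBounds σs σ ν p C c δ)
    (hm : Measurable σs) (hC : 0 < C) (hc : 0 < c) (hδ : 0 < δ) (hp : 1 ≤ p) (b b' : ℕ)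
    {θ w₀ : ∀ d : ℕ, E d} {γ : ℕ → ℝ} (hinit : GoodInit b θ w₀)
    (hγ : PolylogComparable b' γ (stepScale p))
    (hγm : ∀ᶠ d : ℕ in atTop,
      γ d ≤ stepScale p d / Real.log d ^ (b * (p - 2 + 2) + 2)) {a' : ℕ} {T : ℕ → ℕ}
    (hT : ∀ᶠ d : ℕ in atTop,
      Real.log d ^ (b' + b * (p - 2) + 2) * iterScale p d ≤ (T d : ℝ) ∧
        (T d : ℝ) ≤ Real.log d ^ a' * iterScale p d) :
    Tendsto (fun d : ℕ => dataLaw d (ν d)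
        {ω | 1 / Real.log d ^ 1 ≤ alignment σs σ (γ d) (θ d) (w₀ d) ω (T d)})
      atTop (𝓝 1) := by
  set r := p - 2 with hr
  refine tendsto_measure_one _ _ (20 * C / c * 2 ^ (r + 2) + 128 * C / δ ^ 2) ?_
  filter_upwards [hγ, hinit.2, hγm, hT, eventually_ge_atTop 1,
    tendsto_log_natCast.eventually_ge_atTop 1,
    tendsto_log_natCast.eventually_ge_atTop (2 / δ),
    tendsto_log_natCast.eventually_ge_atTop (4 * C * 2 ^ r / c),
    tendsto_log_natCast.eventually_ge_atTop (10 * 2 ^ r / c),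
    eventually_mul_log_pow_le_sqrt (4 * C * 2 ^ (r + 1) / c) (b * (r + 1)),
    tendsto_sqrt_natCast.eventually_ge_atTop (24 * C / δ),
    tendsto_sqrt_natCast.eventually_ge_atTop c,
    eventually_mul_log_pow_le_sqrt 3 b,
    eventually_mul_log_pow_le_sqrt (1 / δ) b,
    eventually_mul_log_pow_le_sqrt 1 (a' + 1)]
    with d ⟨hγl, hγu⟩ ⟨hκl, hκu⟩ hγW ⟨hTl, hTu⟩ hd hL hLδ l1 l6 l2 l3 l4 l5 l8 l7
  have hd1 : (1 : ℝ) ≤ d := by exact_mod_cast hd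
  have hx1 : 1 ≤ Real.sqrt d := Real.one_le_sqrt.2 hd1
  have hdx : (d : ℝ) = Real.sqrt d ^ 2 := (Real.sq_sqrt (by positivity)).symm
  have hexp := exp_two_mul_log hd
  rw [stepScale_eq hp hd, ← hr] at hγl hγu hγW
  rw [rpow_neg_half_eq] at hκl hκu
  rw [iterScale_eq p d hp, ← hr] at hTl hTu
  set x := Real.sqrt d with hx
  set L := Real.log d with hLdef
  have hx0 : 0 < x := by linarith
  have hL0 : 0 < L := by linarith
  obtain ⟨hθ, hw⟩ := hinit.1 d hd
  have hγ0 : 0 ≤ γ d := le_trans (by positivity) hγl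
  rw [div_le_iff₀ hc] at l1 l6
  rw [div_le_iff₀ hδ] at l3 hLδ
  rw [div_mul_eq_mul_div, div_le_iff₀ hc] at l2
  rw [div_mul_eq_mul_div, one_mul, div_le_iff₀ hδ] at l8
  have hLb : 1 ≤ L ^ b := one_le_pow₀ hL
  have hκu' : (inner ℝ (θ d) (w₀ d) : ℝ) ≤ L ^ b / x := by rwa [mul_one_div] at hκu
  have hκδ : (inner ℝ (θ d) (w₀ d) : ℝ) ≤ δ := by
    refine hκu'.trans ?_
    rw [div_le_iff₀ hx0]
    linarith
  have hκ2 : (inner ℝ (θ d) (w₀ d) : ℝ) ≤ 2 := by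
    linarith [(abs_le.1 (abs_inner_le_one hθ hw)).2]
  have hκ0 : (0 : ℝ) < inner ℝ (θ d) (w₀ d) := lt_of_lt_of_le (by positivity) hκl
  obtain ⟨h1, h2, h3, h4, N, hNT, hN, h5⟩ := sufficiency_arithmetic (r := r) (n := T d)
    (Y := L ^ b') (Z := L ^ b) (W := L ^ (b * (r + 2) + 2)) (A := L ^ (b' + b * r + 2))
    (A' := L ^ a') (γ := γ d) (κ := inner ℝ (θ d) (w₀ d)) hC hc hδ hx1 hL hexp
    (one_le_pow₀ hL) hLb (by rw [pow_add, pow_mul]) (by rw [pow_add, pow_add, pow_mul L b r])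
    (by rw [← div_div]; exact hγW) (by rw [← div_div]; exact hγl)
    (by rw [← div_div]; exact hκl) hTl hTu hκ2 (by linarith)
    (by rw [← pow_mul]; linarith) (by linarith) l4 (by linarith) (by linarith)
    (by rw [pow_succ] at l7; linarith)
  rw [← hdx] at h1 h2 h3 h4 h5
  refine (hB.sufficiency hm hC hc hδ hd hγ0 hθ hw (r := r) (by omega) rfl hκ0 hκδ h1 h2 h3 hNT
    hN).trans ?_
  have hKL : 20 * C / c * 2 ^ (r + 2) / L + 128 * C / δ ^ 2 / L =
      (20 * C / c * 2 ^ (r + 2) + 128 * C / δ ^ 2) / L := (add_div _ _ _).symm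
  rw [← hKL, ENNReal.ofReal_add (by positivity) (by positivity)]
  refine add_le_add (measure_mono fun ω hω => ?_)
    (add_le_add (ENNReal.ofReal_le_ofReal h5) (ENNReal.ofReal_le_ofReal h4))
  have hω' : δ / 2 ≤ alignment σs σ (γ d) (θ d) (w₀ d) ω (T d) := hω
  -- The alignment reached is the constant `δ / 2`, which exceeds `1 / log d` once `log d ≥ 2 / δ`.
  refine le_trans ?_ hω'
  rw [pow_one, div_le_div_iff₀ hL0 (by norm_num)]
  linarith

end Asymptotics

end OnlineSGD

/-! ### Assembly of the two halves -/

theorem mainTheorem4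
    (σs : ℝ → ℝ) (hσs_meas : Measurable σs) (hσs_growth : OnlineSGD.PolynomialGrowth σs)
    (σ : Polynomial ℝ)
    (ν : ℕ → Measure ℝ) [∀ d, IsProbabilityMeasure (ν d)]
    (hν_symm : ∀ d, OnlineSGD.IsSymmetricLaw (ν d))
    (hν_tail : OnlineSGD.UniformlySubWeibull ν)
    (p : ℕ) (hp : OnlineSGD.IsInformationExponent σs p)
    (hpos : 0 < OnlineSGD.hermiteCoeff σs p * OnlineSGD.hermiteCoeff (fun z => σ.eval z) p)
    (b : ℕ) :
    -- necessity: fewer iterations do not reach any given inverse polylogarithmic alignment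
    (∀ b' c : ℕ, ∃ a : ℕ, ∀ (θ w₀ : ∀ d : ℕ, OnlineSGD.E d) (γ : ℕ → ℝ),
      OnlineSGD.GoodInit b θ w₀ →
      OnlineSGD.PolylogComparable b' γ (OnlineSGD.stepScale p) →
      Tendsto (fun d : ℕ => OnlineSGD.dataLaw d (ν d)
          {ω | ∀ t : ℕ, (t : ℝ) ≤ OnlineSGD.iterScale p d / Real.log d ^ a →
            OnlineSGD.alignment σs σ (γ d) (θ d) (w₀ d) ω t < 1 / Real.log d ^ c})
        atTop (𝓝 1)) ∧
    -- sufficiency: that many iterations reach some inverse polylogarithmic alignment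
    (∃ m : ℕ, ∀ b' : ℕ, ∃ a c : ℕ, ∀ (θ w₀ : ∀ d : ℕ, OnlineSGD.E d) (γ : ℕ → ℝ),
      OnlineSGD.GoodInit b θ w₀ →
      OnlineSGD.PolylogComparable b' γ (OnlineSGD.stepScale p) →
      (∀ᶠ d : ℕ in atTop, γ d ≤ OnlineSGD.stepScale p d / Real.log d ^ m) →
      ∀ (a' : ℕ) (T : ℕ → ℕ),
        (∀ᶠ d : ℕ in atTop, Real.log d ^ a * OnlineSGD.iterScale p d ≤ (T d : ℝ) ∧
          (T d : ℝ) ≤ Real.log d ^ a' * OnlineSGD.iterScale p d) →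
        Tendsto (fun d : ℕ => OnlineSGD.dataLaw d (ν d)
            {ω | 1 / Real.log d ^ c ≤
              OnlineSGD.alignment σs σ (γ d) (θ d) (w₀ d) ω (T d)})
          atTop (𝓝 1)) := by

  obtain ⟨C, c, δ, hC, hc, hδ, hB⟩ :=
    OnlineSGD.exists_increment_bounds hσs_meas hσs_growth σ hν_symm hν_tail hp hpos
  have hB' : OnlineSGD.IncrementBounds σs σ ν p C c δ := hB
  have hp1 : 1 ≤ p := hp.1.1
  -- In the second half `m` comes from `L γ ≪ κ_0^(p-2+2)` and does not involve `b'`; `a` does,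
  -- because the lower bound on `γ` governs how long escape takes.
  refine ⟨fun b' c => hB'.weak_recovery_necessity hσs_meas hC hp1 b b' c,
    b * (p - 2 + 2) + 2, fun b' => ⟨b' + b * (p - 2) + 2, 1, ?_⟩⟩
  intro θ w₀ γ hinit hγ hγm a' T hT
  exact hB'.weak_recovery_sufficiency hσs_meas hC hc hδ hp1 b b' hinit hγ hγm hT
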